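/- **Model.** A partially erased graph $G$ consists of the adjacency lists of a simple undirected graph on the vertex set $\{0,\dots,n-1\}$, in which some of the list entries are replaced by a symbol $\bot$. Let $2m$ be the total number of entries and $\bar d=2m/n$ the average degree. $G$ is $\alpha$-erased if at most $2\alpha m$ entries are erased. A completion of $G$ is a simple graph having adjacency lists that coincide with those of $G$ on all nonerased entries. $G$ is connected if some completion is connected; $G$ is $\varepsilon$-far from connected if every completion differs in at least $\varepsilon m$ edges from every connected graph on the same vertex set. An algorithm is a fixed program for a randomized unit-cost random access machine (with real registers holding the real parameters) that is given $n,\varepsilon,\alpha$, may draw independent uniformly random vertices, and accesses $G$ by degree queries ($v\mapsto\deg v$) and neighbor queries ($(v,i)\mapsto$ the $i$-th entry of the list of $v$). It is an $\alpha$-erasure-resilient $\varepsilon$-tester for connectedness with one-sided error if it always accepts every $\alpha$-erased graph that is connected, and rejects with probability at least $2/3$ every $\alpha$-erased graph that is $\varepsilon$-far from connected. Complexities are worst case over the random choices, and $O(f)$ stands for at most $C\max\{1,f\}$ with an absolute constant $C$. **Theorem.** 1. There is an algorithm which, given in addition the average degree $\bar d>0$ of the input graph, is a one-sided-error $\alpha$-erasure-resilient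 $\varepsilon$-tester for connectedness of graphs with average degree $\bar d$, for every $\varepsilon\in(0,2/\bar d)$ and $\alpha\in[0,\varepsilon/2)$, and whose query complexity and running time are $$O\Big(\min\Big\{\frac1{((\varepsilon-2\alpha)\bar d)^2},\ \frac1{\varepsilon-2\alpha}\log\frac1{(\varepsilon-2\alpha)\bar d}\Big\}\Big).$$ 2. There is an algorithm which, without being given $\bar d$, is a one-sided-error $\alpha$-erasure-resilient $\varepsilon$-tester for connectedness of graphs on $n\ge2$ vertices, for every $\varepsilon>0$ and $\alpha\in[0,\varepsilon/2)$, and whose query complexity and running time are $$O\Big(\frac1{\varepsilon-2\alpha}\log\frac1{\varepsilon-2\alpha}\Big).$$ -/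

import Mathlib

open MeasureTheory

/-! ## Partially erased graphs -/

/-- `L` is an adjacency-list representation of the simple graph `H`: the list of `v` holds every
neighbour of `v` exactly once, in an arbitrary order. -/
def IsAdjList {n : ℕ} (H : SimpleGraph (Fin n)) (L : Fin n → List (Fin n)) : Prop :=
  ∀ v, (L v).Nodup ∧ ∀ w, w ∈ L v ↔ H.Adj v w

/-- `L` coincides with `A` on all nonerased entries (`none` is the erasure symbol `⊥`). -/
def Agrees {n : ℕ} (A : Fin n → List (Option (Fin n))) (L : Fin n → List (Fin n)) : Prop :=
  ∀ v, List.Forall₂ (fun a w => ∀ u, a = some u → u = w) (A v) (L v)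

/-- A partially erased graph on the vertex set `Fin n`: the adjacency lists of a simple graph,
with some entries replaced by `none`. -/
structure ErasedGraph (n : ℕ) where
  adj : Fin n → List (Option (Fin n))
  valid : ∃ (H : SimpleGraph (Fin n)) (L : Fin n → List (Fin n)), IsAdjList H L ∧ Agrees adj L

namespace ErasedGraph

variable {n : ℕ}

/-- The simple graph `H` is (represented by) a completion of `G`. -/
def IsCompletion (G : ErasedGraph n) (H : SimpleGraph (Fin n)) : Prop :=
  ∃ L : Fin n → List (Fin n), IsAdjList H L ∧ Agrees G.adj L

/-- The total number `2m` of entries in the adjacency lists. -/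
def numEntries (G : ErasedGraph n) : ℕ := ∑ v, (G.adj v).length

/-- The number of erased entries. -/
def numErased (G : ErasedGraph n) : ℕ := ∑ v, (G.adj v).count none

/-- The number `m` of edges of any completion. -/
noncomputable def numEdges (G : ErasedGraph n) : ℝ := (G.numEntries : ℝ) / 2

/-- The average degree `2m / n`. -/
noncomputable def avgDegree (G : ErasedGraph n) : ℝ := (G.numEntries : ℝ) / n

/-- `G` is `α`-erased: at most an `α` fraction of all entries is erased. -/
def IsErased (G : ErasedGraph n) (α : ℝ) : Prop := (G.numErased : ℝ) ≤ α * G.numEntries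

/-- Some completion of `G` has the property `P`. -/
def Satisfies (G : ErasedGraph n) (P : SimpleGraph (Fin n) → Prop) : Prop :=
  ∃ H, G.IsCompletion H ∧ P H

/-- Every completion of `G` differs in at least `ε m` edges from every graph with property `P`. -/
def IsFar (G : ErasedGraph n) (ε : ℝ) (P : SimpleGraph (Fin n) → Prop) : Prop :=
  ∀ H, G.IsCompletion H → ∀ K, P K →
    ε * G.numEdges ≤ ((symmDiff H.edgeSet K.edgeSet).ncard : ℝ)

/-- The answer to the degree query `v` (`0` if `v` is not a vertex). -/
def degreeAnswer (G : ErasedGraph n) (v : ℕ) : ℕ :=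
  if h : v < n then (G.adj ⟨v, h⟩).length else 0

/-- The answer to the neighbour query `(v, i)`, with `i` counted from `0`. Vertices are the
numbers `0, …, n - 1`; the symbol `⊥` is represented by the number `n`, which is also the answer
to a query that does not address an entry of an adjacency list. -/
def neighborAnswer (G : ErasedGraph n) (v i : ℕ) : ℕ :=
  if h : v < n then
    match (G.adj ⟨v, h⟩)[i]? with
    | some (some w) => w
    | _ => n
  else n

end ErasedGraph

/-! ## The machine model

A randomized random access machine with query access to a partially erased graph. It has natural
number registers, a natural number memory with indirect addressing, and real registers for the
real parameters, with the field operations and comparisons but no rounding. On natural numbers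
it can only copy, add, subtract and compare. A program is a fixed finite text; every elementary
operation and every evaluation of a test takes one unit of time. -/

/-- Elementary operations; the arguments are numbers of registers, except for the constants. -/
inductive Instr : Type where
  /-- `R r := c` -/
  | const (r c : ℕ)
  /-- `R r := R a` -/
  | copy (r a : ℕ)
  /-- `R r := R a + R b` -/
  | add (r a b : ℕ)
  /-- `R r := R a - R b`, truncated at `0` -/
  | sub (r a b : ℕ)
  /-- `R r := M (R a)` -/
  | load (r a : ℕ)
  /-- `M (R a) := R b` -/
  | store (a b : ℕ)
  /-- `X x := c` -/
  | rconst (x c : ℕ)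
  /-- `X x := R a` -/
  | rcast (x a : ℕ)
  /-- `X x := X y + X z` -/
  | radd (x y z : ℕ)
  /-- `X x := X y - X z` -/
  | rsub (x y z : ℕ)
  /-- `X x := X y * X z` -/
  | rmul (x y z : ℕ)
  /-- `X x := X y / X z`, which is `0` if `X z = 0` -/
  | rdiv (x y z : ℕ)
  /-- `R r :=` a uniformly random vertex -/
  | sample (r : ℕ)
  /-- `R r :=` the answer to the degree query `R a` -/
  | degree (r a : ℕ)
  /-- `R r :=` the answer to the neighbour query `(R a, R b)` -/
  | neighbor (r a b : ℕ)

/-- Tests. -/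
inductive Test : Type where
  /-- `R a < R b` -/
  | lt (a b : ℕ)
  /-- `R a = R b` -/
  | eq (a b : ℕ)
  /-- `X x < X y` -/
  | rlt (x y : ℕ)

/-- Programs. -/
inductive Prog : Type where
  | op (i : Instr)
  | seq (p q : Prog)
  | ite (t : Test) (p q : Prog)
  | while (t : Test) (p : Prog)

/-- A configuration, with the number of random vertices drawn so far, the number of steps made
so far and the number of queries made so far. -/
structure State : Type where
  reg : ℕ → ℕ
  mem : ℕ → ℕ
  real : ℕ → ℝ
  drawn : ℕ
  time : ℕ
  queries : ℕ

namespace State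

/-- Charge one unit of time. -/
def tick (s : State) : State := { s with time := s.time + 1 }

/-- Charge one query. -/
def charge (s : State) : State := { s with queries := s.queries + 1 }

/-- Write `c` into the register `r`. -/
def setReg (s : State) (r c : ℕ) : State := { s with reg := Function.update s.reg r c }

/-- Write `c` into the memory cell `a`. -/
def setMem (s : State) (a c : ℕ) : State := { s with mem := Function.update s.mem a c }

/-- Write `c` into the real register `x`. -/
noncomputable def setReal (s : State) (x : ℕ) (c : ℝ) : State :=
  { s with real := Function.update s.real x c }

/-- The initial configuration: the number `n` of vertices is in register `1`, the real parameters
are in the real registers `0, 1, 2`, and everything else is `0`. -/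
noncomputable def initial (n : ℕ) (x y z : ℝ) : State where
  reg := Function.update (fun _ => 0) 1 n
  mem := fun _ => 0
  real := fun i => if i = 0 then x else if i = 1 then y else if i = 2 then z else 0
  drawn := 0
  time := 0
  queries := 0

end State

/-- The effect of an elementary operation; `ω` is the sequence of random vertices. -/
noncomputable def Instr.run {n : ℕ} (G : ErasedGraph n) (ω : ℕ → Fin n) (s : State) :
    Instr → State
  | const r c => (s.setReg r c).tick
  | copy r a => (s.setReg r (s.reg a)).tick
  | add r a b => (s.setReg r (s.reg a + s.reg b)).tick
  | sub r a b => (s.setReg r (s.reg a - s.reg b)).tick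
  | load r a => (s.setReg r (s.mem (s.reg a))).tick
  | store a b => (s.setMem (s.reg a) (s.reg b)).tick
  | rconst x c => (s.setReal x (c : ℝ)).tick
  | rcast x a => (s.setReal x (s.reg a : ℝ)).tick
  | radd x y z => (s.setReal x (s.real y + s.real z)).tick
  | rsub x y z => (s.setReal x (s.real y - s.real z)).tick
  | rmul x y z => (s.setReal x (s.real y * s.real z)).tick
  | rdiv x y z => (s.setReal x (s.real y / s.real z)).tick
  | sample r => { (s.setReg r (ω s.drawn)).tick with drawn := s.drawn + 1 }
  | degree r a => (s.setReg r (G.degreeAnswer (s.reg a))).tick.charge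
  | neighbor r a b => (s.setReg r (G.neighborAnswer (s.reg a) (s.reg b))).tick.charge

/-- The test holds in the configuration `s`. -/
def Test.Holds (s : State) : Test → Prop
  | lt a b => s.reg a < s.reg b
  | eq a b => s.reg a = s.reg b
  | rlt x y => s.real x < s.real y

/-- `Exec G ω p s s'`: started in `s`, the program `p` halts, in the configuration `s'`. -/
inductive Exec {n : ℕ} (G : ErasedGraph n) (ω : ℕ → Fin n) : Prog → State → State → Prop where
  | op (i : Instr) (s : State) : Exec G ω (.op i) s (i.run G ω s)
  | seq {p q : Prog} {s s' s'' : State} (hp : Exec G ω p s s') (hq : Exec G ω q s' s'') :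
      Exec G ω (.seq p q) s s''
  | ite_true {t : Test} {p q : Prog} {s s' : State} (ht : t.Holds s)
      (hp : Exec G ω p s.tick s') : Exec G ω (.ite t p q) s s'
  | ite_false {t : Test} {p q : Prog} {s s' : State} (ht : ¬ t.Holds s)
      (hq : Exec G ω q s.tick s') : Exec G ω (.ite t p q) s s'
  | while_true {t : Test} {p : Prog} {s s' s'' : State} (ht : t.Holds s)
      (hp : Exec G ω p s.tick s') (hw : Exec G ω (.while t p) s' s'') :
      Exec G ω (.while t p) s s''
  | while_false {t : Test} {p : Prog} {s : State} (ht : ¬ t.Holds s) :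
      Exec G ω (.while t p) s s.tick

/-- The machine is deterministic once the random vertices are fixed. -/
theorem Exec.unique {n : ℕ} {G : ErasedGraph n} {ω : ℕ → Fin n} {p : Prog} {s s₁ s₂ : State}
    (h₁ : Exec G ω p s s₁) (h₂ : Exec G ω p s s₂) : s₁ = s₂ := by
  induction h₁ generalizing s₂ with
  | op i s => cases h₂; rfl
  | seq hp hq ihp ihq =>
    cases h₂ with
    | seq hp' hq' => obtain rfl := ihp hp'; exact ihq hq'
  | ite_true ht hp ih =>
    cases h₂ with
    | ite_true ht' hp' => exact ih hp'
    | ite_false ht' hp' => exact absurd ht ht'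
  | ite_false ht hp ih =>
    cases h₂ with
    | ite_true ht' hp' => exact absurd ht' ht
    | ite_false ht' hp' => exact ih hp'
  | while_true ht hp hw ihp ihw =>
    cases h₂ with
    | while_true ht' hp' hw' => obtain rfl := ihp hp'; exact ihw hw'
    | while_false ht' => exact absurd ht ht'
  | while_false ht =>
    cases h₂ with
    | while_true ht' hp' hw' => exact absurd ht' ht
    | while_false ht' => rfl

/-- The law of a sequence of independent uniformly random vertices. -/
noncomputable def randomVertices (n : ℕ) [NeZero n] : Measure (ℕ → Fin n) :=
  Measure.infinitePi fun _ : ℕ => (PMF.uniformOfFintype (Fin n)).toMeasure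

/-- The run on the random sequence `ω` with real inputs `x, y, z` halts and accepts
(register `0` holds a nonzero number). -/
def Accepts {n : ℕ} (p : Prog) (x y z : ℝ) (G : ErasedGraph n) (ω : ℕ → Fin n) : Prop :=
  ∃ s, Exec G ω p (State.initial n x y z) s ∧ s.reg 0 ≠ 0

/-- The run on the random sequence `ω` with real inputs `x, y, z` halts and rejects
(register `0` holds `0`). -/
def Rejects {n : ℕ} (p : Prog) (x y z : ℝ) (G : ErasedGraph n) (ω : ℕ → Fin n) : Prop :=
  ∃ s, Exec G ω p (State.initial n x y z) s ∧ s.reg 0 = 0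

/-- In the worst case over the random choices, the run halts after at most `B` steps and makes at
most `B` queries. -/
def HasComplexityAtMost {n : ℕ} (p : Prog) (x y z : ℝ) (G : ErasedGraph n) (B : ℝ) : Prop :=
  ∀ ω : ℕ → Fin n, ∃ s, Exec G ω p (State.initial n x y z) s ∧
    (s.queries : ℝ) ≤ B ∧ (s.time : ℝ) ≤ B

/-- On the input `G`, the program meets the requirements on a tester with one-sided error for the
property `P` with proximity parameter `ε`. -/
def TestsOneSided {n : ℕ} [NeZero n] (p : Prog) (x y z : ℝ) (G : ErasedGraph n) (ε : ℝ)
    (P : SimpleGraph (Fin n) → Prop) : Prop :=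
  (G.Satisfies P → ∀ ω : ℕ → Fin n, Accepts p x y z G ω) ∧
    (G.IsFar ε P → 2 / 3 ≤ randomVertices n {ω | Rejects p x y z G ω})

/-!
A trial draws a random vertex `v` and explores its component by breadth-first search, reading at most
`a * w` entries, where `a` is the level of the trial and the weight `w` is either `a` itself or the
degree of `v`. A trial that meets an erased entry or exceeds its limit is given up. A trial that
reads the lists of a set `C` of fewer than `n` vertices completely, all entries being nonerased and
leading back to `C`, proves that no completion is connected (`not_satisfies_connected`), so
rejecting is then correct.

A completion of a graph that is far from connected has at least `ε * m` components, because adding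
one edge per component makes it connected, and at most `2 * α * m` of them contain an erased entry
(`hasDensity_of_isFar`). In each of the remaining `(ε - 2 * α) * m` components `C` the vertices have
total weight at least `1` if `v` gets the weight `ρ v = 1 / |C|`, or `ρ v = deg v / e(C)` with `e(C)`
the number of entries of the lists of `C`. The average of `ρ` over all `n` vertices is therefore at
least `δ = (ε - 2 * α) * d / 2`, and a trial from `v` succeeds from the level `1 / ρ v` on, since
`e(C) ≤ |C| ^ 2`.

Trials are organized in phases `N = 1, 2, 4, …`; in phase `N` there are `N / a` trials at each
level `a = 1, 2, 4, …, N`. The expected number of successful trials in phase `N` is at least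
`(N * δ - 1) / 2` (`two_le_sum_goodProb`). With the weights `w = a` the phases up to `N` cost
`O(N ^ 2)`; with the weights `w = deg v` a trial at level `a` has an expected cost of `O(a * d + 1)`,
so that these phases have an expected cost of `O(N * (d * log N + 1))`. For `N` of the order of
`1 / δ` this yields the two terms of the minimum, and Markov's inequality turns the expectation into
a fixed budget (`two_thirds_le_finds`). The tester that knows `d` computes both budgets and uses the
smaller one. The search itself only needs the budget, not the number of phases, and for `w = deg v`
the degree cancels from the budget, so that a tester that does not know `d` can use the second
search; if `d ≤ 1 / 2`, then isolated vertices are found at once.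

On the machine, the search is a single loop whose body has no loops, carries out one step of the
search and spends one unit of the budget. So the running time is bounded by the budget
(`exec_while`), whatever the random vertices are, and the analysis can be done for an abstract search
(`Search.step`) that the loop simulates (`Represents.eval_stepProg`).
-/

/-! ### Loop-free programs and loops with a variant -/

section Machine

variable {n : ℕ} (G : ErasedGraph n) (ω : ℕ → Fin n)

open Classical in
/-- The final configuration of a loop-free program. A loop is sent to the identity, which is
never used. -/
noncomputable def Prog.eval : Prog → State → State
  | .op i, s => i.run G ω s
  | .seq p q, s => q.eval (p.eval s)
  | .ite t p q, s => if t.Holds s then p.eval s.tick else q.eval s.tick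
  | .while _ _, s => s

/-- The program contains no loop. -/
def Prog.LoopFree : Prog → Prop
  | .op _ => True
  | .seq p q => p.LoopFree ∧ q.LoopFree
  | .ite _ p q => p.LoopFree ∧ q.LoopFree
  | .while _ _ => False

/-- The number of operations and tests in the text of a loop-free program, a bound on its
running time. -/
def Prog.size : Prog → ℕ
  | .op _ => 1
  | .seq p q => p.size + q.size
  | .ite _ p q => 1 + p.size + q.size
  | .while _ _ => 0

/-- The instructions of a list, followed by a program. -/
def Prog.pre : List Instr → Prog → Prog
  | [], p => p
  | i :: l, p => .seq (.op i) (Prog.pre l p)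

theorem Prog.LoopFree.exec {p : Prog} (hp : p.LoopFree) (s : State) :
    Exec G ω p s (p.eval G ω s) := by
  induction p generalizing s with
  | op i => exact .op i s
  | seq p q ihp ihq => exact .seq (ihp hp.1 s) (ihq hp.2 _)
  | ite t p q ihp ihq =>
    by_cases ht : t.Holds s
    · simpa [Prog.eval, ht] using Exec.ite_true (q := q) ht (ihp hp.1 s.tick)
    · simpa [Prog.eval, ht] using Exec.ite_false (p := p) ht (ihq hp.2 s.tick)
  | _ => exact hp.elim

theorem Instr.run_time_queries (i : Instr) (s : State) :
    (i.run G ω s).time ≤ s.time + 1 ∧ (i.run G ω s).queries ≤ s.queries + 1 := by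
  cases i <;> simp [Instr.run, State.tick, State.charge, State.setReg, State.setMem,
    State.setReal]

theorem Prog.eval_time_queries (p : Prog) (s : State) :
    (p.eval G ω s).time ≤ s.time + p.size ∧ (p.eval G ω s).queries ≤ s.queries + p.size := by
  induction p generalizing s with
  | op i => exact i.run_time_queries G ω s
  | seq p q ihp ihq =>
    have h1 := ihp s
    have h2 := ihq (p.eval G ω s)
    simp only [Prog.eval, Prog.size]
    omega
  | ite t p q ihp ihq =>
    have h1 := ihp s.tick
    have h2 := ihq s.tick
    simp only [State.tick] at h1 h2
    simp only [Prog.eval, Prog.size, State.tick]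
    split <;> omega
  | _ => simp [Prog.eval, Prog.size]

/-- A loop with a loop-free body, an invariant `I` and a variant `F` halts in a number of steps
proportional to the initial value of the variant. -/
theorem exec_while {t : Test} {p : Prog} (hp : p.LoopFree) (I : State → Prop) (F : State → ℕ)
    (htick : ∀ s, I s → I s.tick)
    (hstep : ∀ s, I s → t.Holds s → I (p.eval G ω s.tick) ∧ F (p.eval G ω s.tick) < F s)
    (s : State) (hs : I s) :
    ∃ s', Exec G ω (.while t p) s s' ∧ I s' ∧
      s'.time ≤ s.time + F s * (p.size + 1) + 1 ∧
      s'.queries ≤ s.queries + F s * (p.size + 1) + 1 := by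
  induction hF : F s using Nat.strong_induction_on generalizing s with
  | _ f ih =>
    by_cases ht : t.Holds s
    · obtain ⟨hI, hlt⟩ := hstep s hs ht
      obtain ⟨s', he, hI', h1, h2⟩ := ih _ (hF ▸ hlt) _ hI rfl
      refine ⟨s', .while_true ht (hp.exec G ω s.tick) he, hI', ?_⟩
      obtain ⟨h3, h4⟩ := p.eval_time_queries G ω s.tick
      simp only [State.tick] at h1 h2 h3 h4
      have h5 : (F (p.eval G ω s.tick) + 1) * (p.size + 1) ≤ f * (p.size + 1) :=
        Nat.mul_le_mul_right _ (by omega)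
      simp only [State.tick] at h5
      rw [add_mul] at h5
      omega
    · exact ⟨s.tick, .while_false ht, htick s hs, by dsimp only [State.tick]; omega,
        by dsimp only [State.tick]; omega⟩

end Machine

/-! ### The schedule of trials and the search from a random vertex -/

/-- A trial of the schedule: phase `N`, level `a`, and the number `k` of units of the phase used up
at this level. Trials at level `a` take `a` units, and every level of phase `N` has `N` units. -/
structure Slot : Type where
  phase : ℕ
  level : ℕ
  used : ℕ

/-- The trial following a given one; the levels of a phase and the phases themselves run through
the powers of two. -/
def Slot.next (s : Slot) : Slot :=
  if s.used + s.level < s.phase then ⟨s.phase, s.level, s.used + s.level⟩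
  else if s.phase < s.level + s.level then ⟨s.phase + s.phase, 1, 0⟩
  else ⟨s.phase, s.level + s.level, 0⟩

/-- The slot of the `t`-th trial. -/
def slot : ℕ → Slot
  | 0 => ⟨1, 1, 0⟩
  | t + 1 => (slot t).next

namespace ErasedGraph

variable {n : ℕ} (G : ErasedGraph n)

/-- The degree of a vertex in (any completion of) the graph. -/
def deg (v : Fin n) : ℕ := (G.adj v).length

/-- The factor by which the level of a trial is multiplied to get the number of entries that may
be read: the level itself if `b`, and the degree of the start vertex otherwise. -/
def weight (b : Bool) (a : ℕ) (v : Fin n) : ℕ := if b then a else G.deg v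

/-- The set `C` is closed under taking neighbours, and its lists have no erased entries. -/
def IsClosed (C : Finset (Fin n)) : Prop :=
  ∀ u ∈ C, ∀ x ∈ G.adj u, ∃ w ∈ C, x = some w

/-- The vertex `v` lies in a proper closed set that a trial at level `a` can read completely. -/
def GoodAt (b : Bool) (a : ℕ) (v : Fin n) : Prop :=
  ∃ C : Finset (Fin n), v ∈ C ∧ C.card < n ∧ G.IsClosed C ∧
    ∑ u ∈ C, G.deg u ≤ a * G.weight b a v

end ErasedGraph

/-- The queue with the vertex `w` appended, unless `w` has been seen already. -/
def enqueue {n : ℕ} (q : List (Fin n)) (w : Fin n) : List (Fin n) :=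
  if w ∈ q then q else q ++ [w]

theorem mem_enqueue {n : ℕ} {q : List (Fin n)} {u w : Fin n} :
    u ∈ enqueue q w ↔ u ∈ q ∨ u = w := by
  unfold enqueue
  split_ifs with h
  · exact ⟨.inl, fun h' => h'.elim id fun e => e ▸ h⟩
  · simp

theorem nodup_enqueue {n : ℕ} {q : List (Fin n)} (hq : q.Nodup) (w : Fin n) :
    (enqueue q w).Nodup := by
  unfold enqueue
  split_ifs with h
  · exact hq
  · exact List.nodup_append.2 ⟨hq, by simp, fun a ha b hb hab => h (by
      rw [List.mem_singleton] at hb; rwa [← hb, ← hab])⟩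

theorem length_le_length_enqueue {n : ℕ} (q : List (Fin n)) (w : Fin n) :
    q.length ≤ (enqueue q w).length := by
  unfold enqueue; split_ifs <;> simp

theorem length_enqueue_le {n : ℕ} (q : List (Fin n)) (w : Fin n) :
    (enqueue q w).length ≤ q.length + 1 := by
  unfold enqueue; split_ifs <;> simp

theorem getElem_enqueue {n : ℕ} {q : List (Fin n)} {w : Fin n} {i : ℕ} (hi : i < q.length) :
    (enqueue q w)[i]'(hi.trans_le (length_le_length_enqueue q w)) = q[i] := by
  unfold enqueue
  split_ifs
  · rfl
  · exact List.getElem_append_left hi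

theorem take_enqueue {n : ℕ} {q : List (Fin n)} {w : Fin n} {i : ℕ} (hi : i ≤ q.length) :
    (enqueue q w).take i = q.take i := by
  unfold enqueue
  split_ifs
  · rfl
  · rw [List.take_append_of_le_length hi]

/-- A configuration of the breadth-first search: the number `trial` of trials begun so far, the
list `queue` of all vertices seen in this trial, the position `head` in it of the vertex whose list
is being read, the position `pos` in this list, and the number `lim` of entries that may still be
read. -/
structure Search (n : ℕ) : Type where
  trial : ℕ
  queue : List (Fin n)
  head : ℕ
  pos : ℕ
  lim : ℕ

namespace Search

variable {n : ℕ} (G : ErasedGraph n) (ω : ℕ → Fin n) (b : Bool)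

/-- The beginning of the `t`-th trial. -/
def start (t : ℕ) : Search n :=
  ⟨t + 1, [ω t], 0, 0, (slot t).level * G.weight b (slot t).level (ω t)⟩

/-- The entry to be read next, if the current list has not been read completely. -/
def entry (c : Search n) : Option (Option (Fin n)) :=
  (c.queue[c.head]?).bind fun u => (G.adj u)[c.pos]?

/-- One step of the search; `none` means that a proper closed set has been found. A trial is given
up when it meets an erased entry, exceeds its limit or has seen all vertices. -/
def step (c : Search n) : Option (Search n) :=
  match c.entry G with
  | some (some w) =>
    if c.lim = 0 then some (start G ω b c.trial)
    else some ⟨c.trial, enqueue c.queue w, c.head, c.pos + 1, c.lim - 1⟩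
  | some none => some (start G ω b c.trial)
  | none =>
    if c.head + 1 < c.queue.length then some ⟨c.trial, c.queue, c.head + 1, 0, c.lim⟩
    else if c.queue.length < n then none
    else some (start G ω b c.trial)

/-- The search finds a proper closed set in at most `j` steps. -/
def Finds : ℕ → Search n → Prop
  | 0, _ => False
  | j + 1, c => c.step G ω b = none ∨ ∃ c', c.step G ω b = some c' ∧ Finds j c'

/-- All entries read so far lead to seen vertices. -/
structure Sound (c : Search n) : Prop where
  head_lt : c.head < c.queue.length
  nodup : c.queue.Nodup
  pos_le : c.pos ≤ G.deg (c.queue[c.head]'head_lt)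
  done : ∀ i (hi : i < c.head), ∀ x ∈ G.adj (c.queue[i]'(hi.trans head_lt)),
    ∃ w ∈ c.queue, x = some w
  current : ∀ x ∈ (G.adj (c.queue[c.head]'head_lt)).take c.pos, ∃ w ∈ c.queue, x = some w

/-- An upper bound on the number of steps that remain in the current trial. -/
def potential (c : Search n) : ℕ := 2 * c.lim + (c.queue.length - c.head)

variable {G ω b}

theorem sound_start (t : ℕ) : (start G ω b t).Sound G := by
  refine ⟨by simp [start], by simp [start], by simp [start], ?_, ?_⟩
  · intro i hi; simp [start] at hi
  · intro x hx; simp [start] at hx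

theorem entry_eq {c : Search n} (h : c.head < c.queue.length) :
    c.entry G = (G.adj (c.queue[c.head]))[c.pos]? := by
  simp [entry, h]

theorem Sound.step {c c' : Search n} (hc : c.Sound G) (h : c.step G ω b = some c') :
    c'.Sound G := by
  have he := entry_eq (G := G) hc.head_lt
  unfold Search.step at h
  split at h
  · rename_i w hw
    rw [he] at hw
    split_ifs at h with hl
    · cases h; exact sound_start _
    · cases h
      have hlen := hc.head_lt.trans_le (length_le_length_enqueue c.queue w)
      refine ⟨hlen, nodup_enqueue hc.nodup w, ?_, ?_, ?_⟩
      · dsimp only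
        rw [getElem_enqueue hc.head_lt]
        exact (List.getElem?_eq_some_iff.1 hw).1
      · intro i hi x hx
        dsimp only at hi hx
        rw [getElem_enqueue (hi.trans hc.head_lt)] at hx
        obtain ⟨u, hu, rfl⟩ := hc.done i hi x hx
        exact ⟨u, mem_enqueue.2 (.inl hu), rfl⟩
      · intro x hx
        dsimp only at hx
        rw [getElem_enqueue hc.head_lt, List.take_add_one, hw] at hx
        simp only [Option.toList_some, List.mem_append, List.mem_singleton] at hx
        rcases hx with hx | rfl
        · obtain ⟨u, hu, rfl⟩ := hc.current x hx
          exact ⟨u, mem_enqueue.2 (.inl hu), rfl⟩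
        · exact ⟨w, mem_enqueue.2 (.inr rfl), rfl⟩
  · cases h; exact sound_start _
  · rename_i hn
    rw [he, List.getElem?_eq_none_iff] at hn
    split_ifs at h with h1 h2
    · cases h
      refine ⟨h1, hc.nodup, by simp, ?_, by simp⟩
      intro i hi x hx
      dsimp only at hi hx
      rcases Nat.lt_succ_iff_lt_or_eq.1 hi with hi | rfl
      · exact hc.done i hi x hx
      · exact hc.current x (by rwa [List.take_of_length_le hn])
    · cases h; exact sound_start _

/-- A search that stops has found a proper closed set. -/
theorem Sound.exists_isClosed {c : Search n} (hc : c.Sound G) (h : c.step G ω b = none) :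
    ∃ C : Finset (Fin n), C.Nonempty ∧ C.card < n ∧ G.IsClosed C := by
  have he := entry_eq (G := G) hc.head_lt
  unfold Search.step at h
  split at h
  · split_ifs at h
  · cases h
  · rename_i hn
    rw [he, List.getElem?_eq_none_iff] at hn
    split_ifs at h with h1 h2
    refine ⟨c.queue.toFinset, ⟨c.queue[c.head]'hc.head_lt, by simp⟩, ?_, ?_⟩
    · rwa [List.toFinset_card_of_nodup hc.nodup]
    · intro u hu x hx
      rw [List.mem_toFinset, List.mem_iff_getElem] at hu
      obtain ⟨i, hi, rfl⟩ := hu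
      have : ∃ w ∈ c.queue, x = some w := by
        rcases Nat.lt_or_ge i c.head with hlt | hge
        · exact hc.done i hlt x hx
        · obtain rfl : i = c.head := by have := hc.head_lt; omega
          exact hc.current x (by rwa [List.take_of_length_le hn])
      simpa using this

theorem Finds.succ {j : ℕ} {c : Search n} (h : Finds G ω b j c) : Finds G ω b (j + 1) c := by
  induction j generalizing c with
  | zero => exact h.elim
  | succ j ih =>
    rcases h with h | ⟨c', h, h'⟩
    · exact .inl h
    · exact .inr ⟨c', h, ih h'⟩

theorem Finds.mono {j k : ℕ} (hjk : j ≤ k) {c : Search n} (h : Finds G ω b j c) :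
    Finds G ω b k c := by
  induction hjk with
  | refl => exact h
  | step _ ih => exact ih.succ

/-- If the search from the beginning of the next trial succeeds, then so does the present one,
because a trial does not take more steps than its initial potential. -/
theorem Finds.of_start {j : ℕ} {c : Search n} (hh : c.head < c.queue.length)
    (h : Finds G ω b j (start G ω b c.trial)) : Finds G ω b (c.potential + j) c := by
  induction hp : c.potential using Nat.strong_induction_on generalizing c with
  | _ p ih =>
    have hpos : p = p - 1 + 1 := by unfold potential at hp; omega
    rw [hpos, Nat.add_right_comm]
    rcases hs : c.step G ω b with _ | c'
    · exact .inl hs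
    · refine .inr ⟨c', hs, ?_⟩
      suffices c' = start G ω b c.trial ∨
          (c'.head < c'.queue.length ∧ c'.trial = c.trial ∧ c'.potential < p) by
        rcases this with rfl | ⟨h1, h2, h3⟩
        · exact h.mono (by omega)
        · exact (ih _ h3 h1 (h2 ▸ h) rfl).mono (by omega)
      unfold Search.step at hs
      split at hs
      · rename_i w hw
        split_ifs at hs
        · left; cases hs; rfl
        · right; cases hs
          unfold potential at hp ⊢
          have h1 := length_le_length_enqueue c.queue w
          have h2 := length_enqueue_le c.queue w
          refine ⟨?_, rfl, ?_⟩ <;> dsimp only <;> omega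
      · left; cases hs; rfl
      · split_ifs at hs
        · right; cases hs
          unfold potential at hp ⊢
          refine ⟨?_, rfl, ?_⟩ <;> dsimp only <;> omega
        · left; cases hs; rfl

theorem sum_take_le {C : Finset (Fin n)} (f : Fin n → ℕ) {l : List (Fin n)} (hl : l.Nodup)
    (hC : ∀ u ∈ l, u ∈ C) (k : ℕ) : ((l.take k).map f).sum ≤ ∑ u ∈ C, f u := by
  rw [← List.sum_toFinset _ (hl.sublist (List.take_sublist k l))]
  exact Finset.sum_le_sum_of_subset fun u hu =>
    hC u (List.mem_of_mem_take (List.mem_toFinset.1 hu))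

/-- A trial inside a proper closed set `C` succeeds if the limit suffices for reading what has
not been read yet of the lists of `C`. -/
theorem finds_of_subset {C : Finset (Fin n)} (hC : G.IsClosed C) (hcard : C.card < n)
    {c : Search n} (hc : c.Sound G) (hsub : ∀ u ∈ c.queue, u ∈ C)
    (hlim : ∑ u ∈ C, G.deg u ≤ ((c.queue.take c.head).map G.deg).sum + c.pos + c.lim) :
    Finds G ω b c.potential c := by
  induction hp : c.potential using Nat.strong_induction_on generalizing c with
  | _ p ih =>
    have hh := hc.head_lt
    have hpos : p = p - 1 + 1 := by unfold potential at hp; omega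
    rw [hpos]
    rcases hs : c.step G ω b with _ | c'
    · exact .inl hs
    · refine .inr ⟨c', hs, ?_⟩
      have hc' := hc.step hs
      suffices (∀ u ∈ c'.queue, u ∈ C) ∧ ∑ u ∈ C, G.deg u ≤
          ((c'.queue.take c'.head).map G.deg).sum + c'.pos + c'.lim ∧ c'.potential < p from
        (ih _ this.2.2 hc' this.1 this.2.1 rfl).mono (by have := this.2.2; omega)
      have hhead : ((c.queue.take (c.head + 1)).map G.deg).sum =
          ((c.queue.take c.head).map G.deg).sum + G.deg (c.queue[c.head]) := by
        rw [List.take_add_one, List.getElem?_eq_getElem hh, List.map_append,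
          List.sum_append]
        simp only [Option.toList_some, List.map_cons, List.map_nil, List.sum_singleton]
      have hsum := sum_take_le G.deg hc.nodup hsub (c.head + 1)
      have he := entry_eq (G := G) hc.head_lt
      have hmem : c.queue[c.head] ∈ C := hsub _ (List.getElem_mem hh)
      unfold Search.step at hs
      split at hs
      · rename_i w hw
        rw [he] at hw
        obtain ⟨hlt, hget⟩ := List.getElem?_eq_some_iff.1 hw
        have hwC : w ∈ C := by
          obtain ⟨w', hw', h⟩ := hC _ hmem (some w) (hget ▸ List.getElem_mem hlt)
          cases h; exact hw'
        have hdeg : c.pos < G.deg (c.queue[c.head]) := hlt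
        rw [if_neg (by omega)] at hs
        cases hs
        have hlen := length_enqueue_le c.queue w
        refine ⟨?_, ?_, ?_⟩
        · intro u hu
          rcases mem_enqueue.1 hu with hu | rfl
          · exact hsub u hu
          · exact hwC
        · dsimp only
          rw [take_enqueue hh.le]
          omega
        · unfold potential at hp ⊢
          dsimp only
          omega
      · rename_i hw
        rw [he] at hw
        obtain ⟨hlt, hget⟩ := List.getElem?_eq_some_iff.1 hw
        obtain ⟨w', hw', h⟩ := hC _ hmem none (hget ▸ List.getElem_mem hlt)
        cases h
      · rename_i hn
        rw [he, List.getElem?_eq_none_iff] at hn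
        have hpd := hc.pos_le
        split_ifs at hs with h1 h2
        · cases hs
          refine ⟨hsub, ?_, ?_⟩
          · dsimp only
            rw [hhead]
            omega
          · unfold potential at hp ⊢
            dsimp only
            omega
        · exfalso
          have h3 := Finset.card_le_card (s := c.queue.toFinset) (t := C)
            fun u hu => hsub u (List.mem_toFinset.1 hu)
          rw [List.toFinset_card_of_nodup hc.nodup] at h3
          omega

/-- The potential at the beginning of the `t`-th trial. -/
theorem potential_start (t : ℕ) : (start G ω b t).potential =
    2 * ((slot t).level * G.weight b (slot t).level (ω t)) + 1 := by
  simp [start, potential]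

/-- If one of the first `R` trials starts at a good vertex, then the search succeeds within the
total of the potentials of these trials. -/
theorem finds_of_goodAt {R t : ℕ} (ht : t < R) (hg : G.GoodAt b (slot t).level (ω t)) :
    Finds G ω b (∑ i ∈ Finset.range R, (start G ω b i).potential) (start G ω b 0) := by
  have key : ∀ s m, s + m = t → Finds G ω b (∑ i ∈ Finset.Ico s R, (start G ω b i).potential)
      (start G ω b s) := by
    intro s m
    induction m generalizing s with
    | zero =>
      rintro rfl
      obtain ⟨C, hv, hcard, hC, hsum⟩ := hg
      refine (finds_of_subset hC hcard (sound_start _) ?_ ?_).mono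
        (Finset.single_le_sum (f := fun i => (start G ω b i).potential)
          (fun _ _ => Nat.zero_le _) (Finset.mem_Ico.2 ⟨le_rfl, ht⟩))
      · intro u hu
        simp only [start, List.mem_singleton] at hu
        rw [hu]; exact hv
      · simpa [start] using hsum
    | succ m ih =>
      intro hm
      rw [Finset.sum_eq_sum_Ico_succ_bot (by omega)]
      exact Finds.of_start (c := start G ω b s) (by simp [start]) (ih (s + 1) (by omega))
  rw [Finset.range_eq_Ico]
  exact key 0 t (Nat.zero_add t)

end Search

/-! ### The search as a program -/

/-- The program that begins a new trial. Registers: `1` is `n`, `3` is `1`, `4, 5, 6` are the phase,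
the level and the used units of the next trial, `7` is the number of trials begun, `8` and `9` are
the addresses of the head and of the end of the queue, which begins at address `n`, and `10` is the
position in the current list. The cell of a vertex holds the number of the last trial that has seen
it, which makes it unnecessary to clear the memory between trials. The real register `6` is the
number of entries that may still be read. -/
def startProg (b : Bool) : Prog :=
  .pre [.add 7 7 3, .sample 11, if b then .copy 12 5 else .degree 12 11,
    .rcast 6 5, .rcast 7 12, .rmul 6 6 7, .store 11 7, .copy 8 1, .store 8 11, .add 9 1 3,
    .const 10 0, .add 6 6 5] <|
  .ite (.lt 6 4) (.op (.const 14 0)) <|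
  .pre [.const 6 0, .add 5 5 5] <|
  .ite (.lt 4 5) (.pre [.add 4 4 4] (.op (.const 5 1))) (.op (.const 14 0))

/-- The program that marks the vertex in register `13` as seen and appends it to the queue, if it
has not been seen in this trial. -/
def enqueueProg : Prog :=
  .pre [.add 10 10 3, .load 14 13] <|
  .ite (.eq 14 7) (.op (.const 14 0)) <| .pre [.store 13 7, .store 9 13] (.op (.add 9 9 3))

/-- The program for one step of the search; it spends one unit of the budget, which is kept in the
real register `3`, and clears register `0` and the budget in order to reject. -/
def stepProg (b : Bool) : Prog :=
  .pre [.rsub 3 3 5, .load 11 8, .degree 12 11] <|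
  .ite (.lt 10 12)
    (.ite (.rlt 4 6)
      (.pre [.rsub 6 6 5, .neighbor 13 11 10] <| .ite (.eq 13 1) (startProg b) enqueueProg)
      (startProg b))
    (.pre [.add 8 8 3, .const 10 0] <| .ite (.lt 8 9) (.op (.const 14 0)) <|
      .pre [.sub 14 9 1] <| .ite (.lt 14 1) (.pre [.const 0 0] (.op (.rconst 3 0))) (startProg b))

/-- The search, until it finds a proper closed set or the budget is used up. -/
def searchProg (b : Bool) : Prog := .while (.rlt 4 3) (stepProg b)

theorem loopFree_startProg (b : Bool) : (startProg b).LoopFree := by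
  simp [startProg, Prog.pre, Prog.LoopFree]

theorem loopFree_stepProg (b : Bool) : (stepProg b).LoopFree := by
  simp [stepProg, startProg, enqueueProg, Prog.pre, Prog.LoopFree]

theorem size_startProg (b : Bool) : (startProg b).size = 20 := by
  cases b <;> simp [startProg, Prog.pre, Prog.size]

theorem size_stepProg (b : Bool) : (stepProg b).size = 83 := by
  cases b <;> simp [stepProg, startProg, enqueueProg, Prog.pre, Prog.size]

/-- The registers outside of the search proper, after `t` trials have begun. -/
structure Ready (n t : ℕ) (s : State) : Prop where
  result : s.reg 0 = 1
  vertices : s.reg 1 = n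
  one : s.reg 3 = 1
  phase : s.reg 4 = (slot t).phase
  level : s.reg 5 = (slot t).level
  used : s.reg 6 = (slot t).used
  trial : s.reg 7 = t
  drawn : s.drawn = t
  rzero : s.real 4 = 0
  rone : s.real 5 = 1
  mark_le : ∀ w < n, s.mem w ≤ t

/-- The state `s` represents the configuration `c` of the search. -/
structure Represents {n : ℕ} (s : State) (c : Search n) : Prop where
  ready : Ready n c.trial s
  head : s.reg 8 = n + c.head
  last : s.reg 9 = n + c.queue.length
  pos : s.reg 10 = c.pos
  lim : s.real 6 = c.lim
  queue : ∀ i (hi : i < c.queue.length), s.mem (n + i) = c.queue[i]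
  mark : ∀ w : Fin n, s.mem w = c.trial ↔ w ∈ c.queue

section Simulation

variable {n : ℕ} {G : ErasedGraph n} {ω : ℕ → Fin n} {b : Bool}

theorem degreeAnswer_coe (v : Fin n) : G.degreeAnswer v = G.deg v := by
  simp [ErasedGraph.degreeAnswer, ErasedGraph.deg]

set_option maxHeartbeats 1000000 in
/-- The program begins the next trial and leaves the budget unchanged. -/
theorem Ready.eval_startProg {t : ℕ} {s : State} (h : Ready n t s) :
    Represents ((startProg b).eval G ω s) (Search.start G ω b t) ∧
      ((startProg b).eval G ω s).real 3 = s.real 3 := by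
  obtain ⟨h0, h1, h3, h4, h5, h6, h7, hd, hr4, hr5, hm⟩ := h
  have hn : (ω t : ℕ) < n := (ω t).2
  have hslot : slot (t + 1) = (slot t).next := rfl
  cases b <;> by_cases c1 : (slot t).used + (slot t).level < (slot t).phase <;>
    by_cases c2 : (slot t).phase < (slot t).level + (slot t).level <;>
  · refine ⟨⟨⟨?_, ?_, ?_, ?_, ?_, ?_, ?_, ?_, ?_, ?_, ?_⟩, ?_, ?_, ?_, ?_, ?_, ?_⟩, ?_⟩
    all_goals
      simp [startProg, Prog.pre, Prog.eval, Instr.run, State.tick, State.charge,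
        State.setReg, State.setMem, State.setReal, Test.Holds, h0, h1, h3, h4, h5, h6, h7, hd,
        hr4, hr5, Search.start, hslot, Slot.next, c1, c2, degreeAnswer_coe,
        ErasedGraph.weight]
    · intro w hw
      rw [Function.update_of_ne hw.ne, Function.update_apply]
      split_ifs
      · exact le_rfl
      · exact (hm w hw).trans (Nat.le_succ t)
    · intro w
      rw [Function.update_of_ne w.2.ne, Function.update_apply]
      split_ifs with hw
      · simp [Fin.ext hw]
      · have := hm w w.2
        exact ⟨fun h => by omega, fun h => absurd (congrArg Fin.val h) hw⟩

theorem Represents.tick {s : State} {c : Search n} (h : Represents s c) :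
    Represents s.tick c := by
  obtain ⟨⟨h0, h1, h3, h4, h5, h6, h7, hd, hr4, hr5, hm⟩, h8, h9, h10, hr6, hq, hmark⟩ := h
  exact ⟨⟨h0, h1, h3, h4, h5, h6, h7, hd, hr4, hr5, hm⟩, h8, h9, h10, hr6, hq, hmark⟩

theorem neighborAnswer_coe (v : Fin n) (i : ℕ) : G.neighborAnswer v i =
    match (G.adj v)[i]? with
    | some (some w) => (w : ℕ)
    | _ => n :=
  dif_pos v.2

set_option linter.unusedSimpArgs false

/-- The program carries out one step of the search. -/
theorem Represents.eval_stepProg {s : State} {c : Search n} (h : Represents s c)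
    (hc : c.Sound G) :
    (c.step G ω b = none → ((stepProg b).eval G ω s).reg 0 = 0 ∧
      ((stepProg b).eval G ω s).real 3 = 0 ∧ ((stepProg b).eval G ω s).real 4 = 0) ∧
    ∀ c', c.step G ω b = some c' → Represents ((stepProg b).eval G ω s) c' ∧
      ((stepProg b).eval G ω s).real 3 = s.real 3 - 1 := by
  have key : ∀ s', Ready n c.trial s' → s'.real 3 = s.real 3 - 1 →
      Represents ((startProg b).eval G ω s') (Search.start G ω b c.trial) ∧
        ((startProg b).eval G ω s').real 3 = s.real 3 - 1 := fun s' h1 h2 =>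
    ⟨h1.eval_startProg.1, h1.eval_startProg.2.trans h2⟩
  obtain ⟨⟨h0, h1, h3, h4, h5, h6, h7, hd, hr4, hr5, hm⟩, h8, h9, h10, hr6, hq, hmark⟩ := h
  have hh := hc.head_lt
  have hu := hq c.head hh
  have he := Search.entry_eq (G := G) hh
  set u := c.queue[c.head] with hudef
  rcases hcase : (G.adj u)[c.pos]? with _ | _ | w
  · have hlt : ¬ c.pos < G.deg u := by
      rw [ErasedGraph.deg]; exact not_lt.2 (List.getElem?_eq_none_iff.1 hcase)
    by_cases c1 : c.head + 1 < c.queue.length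
    · have hs : c.step G ω b = some ⟨c.trial, c.queue, c.head + 1, 0, c.lim⟩ := by
        simp [Search.step, he, hcase, c1]
      rw [hs]
      refine ⟨fun h => (nomatch h), ?_⟩
      rintro _ ⟨⟩
      refine ⟨⟨⟨?_, ?_, ?_, ?_, ?_, ?_, ?_, ?_, ?_, ?_, ?_⟩, ?_, ?_, ?_, ?_, ?_, ?_⟩, ?_⟩
      all_goals
        simp [stepProg, Prog.pre, Prog.eval, Instr.run, State.tick, State.charge,
          State.setReg, State.setReal, Test.Holds, h0, h1, h3, h4, h5, h6, h7, hd,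
          hr4, hr5, h8, h9, h10, hr6, hu, degreeAnswer_coe, hlt, add_assoc, c1]
      · exact hm
      · exact hq
      · exact hmark
    · have c1' : ¬ n + (c.head + 1) < n + c.queue.length := by omega
      by_cases c2 : c.queue.length < n
      · have hs : c.step G ω b = none := by
          simp [Search.step, he, hcase, c1, c2]
        rw [hs]
        refine ⟨fun _ => ?_, fun c' h => (nomatch h)⟩
        simp [stepProg, Prog.pre, Prog.eval, Instr.run, State.tick, State.charge,
          State.setReg, State.setReal, Test.Holds, h0, h1, h3, h4, h5, h6, h7, hd,
          hr4, hr5, h8, h9, h10, hr6, hu, degreeAnswer_coe, hlt, add_assoc, c1, c2]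
      · have hs : c.step G ω b = some (Search.start G ω b c.trial) := by
          simp [Search.step, he, hcase, c1, c2]
        rw [hs]
        refine ⟨fun h => (nomatch h), ?_⟩
        rintro _ ⟨⟩
        simp [stepProg, Prog.pre, Prog.eval, Instr.run, State.tick, State.charge,
          State.setReg, State.setReal, Test.Holds, h0, h1, h3, h4, h5, h6, h7, hd,
          hr4, hr5, h8, h9, h10, hr6, hu, degreeAnswer_coe, hlt, add_assoc, c1, c2]
        apply key
        · constructor <;> simp [h0, h1, h3, h4, h5, h6, h7, hd, hr4, hr5]
          exact hm
        · simp
  · have hlt : c.pos < G.deg u := (List.getElem?_eq_some_iff.1 hcase).1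
    have hs : c.step G ω b = some (Search.start G ω b c.trial) := by
      simp [Search.step, he, hcase]
    have ha : G.neighborAnswer u c.pos = n := by simp [neighborAnswer_coe, hcase]
    rw [hs]
    refine ⟨fun h => (nomatch h), ?_⟩
    rintro _ ⟨⟩
    by_cases c1 : c.lim = 0
    all_goals
      simp [stepProg, Prog.pre, Prog.eval, Instr.run, State.tick, State.charge,
          State.setReg, State.setReal, Test.Holds, h0, h1, h3, h4, h5, h6, h7, hd,
          hr4, hr5, h8, h9, h10, hr6, hu, degreeAnswer_coe, hlt, ha, c1, Nat.pos_iff_ne_zero]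
      apply key
      · constructor <;> simp [h0, h1, h3, h4, h5, h6, h7, hd, hr4, hr5]
        exact hm
      · simp
  · have hlt : c.pos < G.deg u := (List.getElem?_eq_some_iff.1 hcase).1
    have ha : G.neighborAnswer u c.pos = w := by simp [neighborAnswer_coe, hcase]
    have hwn : (w : ℕ) ≠ n := w.2.ne
    by_cases c1 : c.lim = 0
    · have hs : c.step G ω b = some (Search.start G ω b c.trial) := by
        simp [Search.step, he, hcase, c1]
      rw [hs]
      refine ⟨fun h => (nomatch h), ?_⟩
      rintro _ ⟨⟩
      simp [stepProg, Prog.pre, Prog.eval, Instr.run, State.tick, State.charge,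
          State.setReg, State.setReal, Test.Holds, h0, h1, h3, h4, h5, h6, h7, hd,
          hr4, hr5, h8, h9, h10, hr6, hu, degreeAnswer_coe, hlt, c1]
      apply key
      · constructor <;> simp [h0, h1, h3, h4, h5, h6, h7, hd, hr4, hr5]
        exact hm
      · simp
    · have hs : c.step G ω b = some ⟨c.trial, enqueue c.queue w, c.head, c.pos + 1,
          c.lim - 1⟩ := by
        simp [Search.step, he, hcase, c1]
      rw [hs]
      refine ⟨fun h => (nomatch h), ?_⟩
      rintro _ ⟨⟩
      have hl : ((c.lim - 1 : ℕ) : ℝ) = c.lim - 1 := by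
        rw [Nat.cast_sub (Nat.one_le_iff_ne_zero.2 c1), Nat.cast_one]
      have hcl := Nat.pos_iff_ne_zero.2 c1
      by_cases c2 : w ∈ c.queue
      · have hmw : s.mem w = c.trial := (hmark w).2 c2
        have hen : enqueue c.queue w = c.queue := if_pos c2
        rw [hen]
        refine ⟨⟨⟨?_, ?_, ?_, ?_, ?_, ?_, ?_, ?_, ?_, ?_, ?_⟩, ?_, ?_, ?_, ?_, ?_, ?_⟩, ?_⟩
        all_goals
          simp [stepProg, Prog.pre, Prog.eval, Instr.run, State.tick, State.charge,
          State.setReg, State.setReal, Test.Holds, h0, h1, h3, h4, h5, h6, h7, hd,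
          hr4, hr5, h8, h9, h10, hr6, hu, degreeAnswer_coe, hlt, enqueueProg, ha, hwn, hmw, hl, hcl]
        · exact hm
        · exact hq
        · exact hmark
      · have hmw : s.mem w ≠ c.trial := fun h => c2 ((hmark w).1 h)
        have hen : enqueue c.queue w = c.queue ++ [w] := if_neg c2
        rw [hen]
        refine ⟨⟨⟨?_, ?_, ?_, ?_, ?_, ?_, ?_, ?_, ?_, ?_, ?_⟩, ?_, ?_, ?_, ?_, ?_, ?_⟩, ?_⟩
        all_goals
          simp [stepProg, Prog.pre, Prog.eval, Instr.run, State.tick, State.charge,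
          State.setReg, State.setReal, Test.Holds, h0, h1, h3, h4, h5, h6, h7, hd,
          hr4, hr5, h8, h9, h10, hr6, hu, degreeAnswer_coe, hlt,
          State.setMem, enqueueProg, ha, hwn, hmw, hl, hcl, add_assoc]
        · intro v hv
          rw [Function.update_of_ne (by omega), Function.update_apply]
          split_ifs
          · exact le_rfl
          · exact hm v hv
        · intro i hi
          rcases hi.lt_or_eq with hi | rfl
          · rw [Function.update_of_ne (by omega), Function.update_of_ne (by omega), hq i hi,
              List.getElem_append_left hi]
          · simp
        · intro v
          rw [Function.update_of_ne (by have := v.2; omega), Function.update_apply]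
          split_ifs with hv
          · simp [Fin.ext hv]
          · rw [hmark]
            exact ⟨.inl, fun h => h.resolve_right fun h => hv (congrArg Fin.val h)⟩

theorem Represents.eval_stepProg_tick {s : State} {c : Search n} (h : Represents s c)
    (hc : c.Sound G) :
    (c.step G ω b = none → ((stepProg b).eval G ω s.tick).reg 0 = 0 ∧
      ((stepProg b).eval G ω s.tick).real 3 = 0 ∧ ((stepProg b).eval G ω s.tick).real 4 = 0) ∧
    ∀ c', c.step G ω b = some c' → Represents ((stepProg b).eval G ω s.tick) c' ∧
      ((stepProg b).eval G ω s.tick).real 3 = s.real 3 - 1 :=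
  h.tick.eval_stepProg hc

/-- The search halts within a number of steps proportional to its budget, and it is right if it
rejects. -/
theorem Represents.exec_searchProg {s : State} {c : Search n} (h : Represents s c)
    (hc : c.Sound G) :
    ∃ s', Exec G ω (searchProg b) s s' ∧
      (s'.reg 0 = 0 → ∃ C : Finset (Fin n), C.Nonempty ∧ C.card < n ∧ G.IsClosed C) ∧
      s'.time ≤ s.time + ⌈s.real 3⌉₊ * 84 + 1 ∧
      s'.queries ≤ s.queries + ⌈s.real 3⌉₊ * 84 + 1 := by
  have hw := exec_while G ω (t := .rlt 4 3) (loopFree_stepProg b)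
    (fun s => (∃ c, Represents s c ∧ c.Sound G) ∨ (s.real 3 = 0 ∧ s.real 4 = 0 ∧
      ∃ C : Finset (Fin n), C.Nonempty ∧ C.card < n ∧ G.IsClosed C))
    (fun s => ⌈s.real 3⌉₊) ?_ ?_ s (.inl ⟨c, h, hc⟩)
  · obtain ⟨s', he, hI, h1, h2⟩ := hw
    rw [size_stepProg] at h1 h2
    refine ⟨s', he, fun h0 => ?_, h1, h2⟩
    rcases hI with ⟨c, hr, -⟩ | ⟨-, -, hC⟩
    · rw [hr.ready.result] at h0
      exact absurd h0 one_ne_zero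
    · exact hC
  · rintro s (⟨c, h, hc⟩ | h)
    · exact .inl ⟨c, h.tick, hc⟩
    · exact .inr h
  · rintro s (⟨c, h, hc⟩ | h) ht
    · have h4 := h.ready.rzero
      simp only [Test.Holds] at ht
      rw [h4] at ht
      obtain ⟨h1, h2⟩ := h.eval_stepProg_tick (ω := ω) (b := b) hc
      rcases hs : c.step G ω b with _ | c'
      · obtain ⟨-, h5, h6⟩ := h1 hs
        refine ⟨.inr ⟨h5, h6, hc.exists_isClosed hs⟩, ?_⟩
        rw [h5]
        simpa using ht
      · obtain ⟨h5, h6⟩ := h2 c' hs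
        refine ⟨.inl ⟨c', h5, hc.step hs⟩, ?_⟩
        rw [h6, ← Nat.cast_one, Nat.ceil_sub_natCast]
        have := Nat.ceil_pos.2 ht
        omega
    · simp [Test.Holds, h.1, h.2.1] at ht

/-- The search rejects if it finds a proper closed set within its budget. -/
theorem Represents.rejects_of_finds {j : ℕ} {s : State} {c : Search n} (h : Represents s c)
    (hc : c.Sound G) (hf : c.Finds G ω b j) (hj : (j : ℝ) ≤ s.real 3) :
    ∃ s', Exec G ω (searchProg b) s s' ∧ s'.reg 0 = 0 := by
  induction j generalizing s c with
  | zero => exact hf.elim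
  | succ j ih =>
    obtain ⟨h1, h2⟩ := h.eval_stepProg_tick (ω := ω) (b := b) hc
    rw [Nat.cast_succ] at hj
    have ht : (Test.rlt 4 3).Holds s := by
      simp only [Test.Holds, h.ready.rzero]
      linarith [(Nat.cast_nonneg j : (0 : ℝ) ≤ j)]
    have he := (loopFree_stepProg b).exec G ω s.tick
    rcases hf with hs | ⟨c', hs, hf⟩
    · obtain ⟨h0, h3, h4⟩ := h1 hs
      exact ⟨_, .while_true ht he (.while_false (by simp [Test.Holds, h3, h4])), h0⟩
    · obtain ⟨h3, h4⟩ := h2 c' hs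
      obtain ⟨s', he', h0⟩ := ih h3 (hc.step hs) hf (by rw [h4]; linarith)
      exact ⟨s', .while_true ht he he', h0⟩

end Simulation

/-! ### Components without erasures -/

namespace ErasedGraph

variable {n : ℕ} {G : ErasedGraph n}

/-- A lower bound `δ` for the average of a function `ρ` on the vertices such that trials from `v`
succeed at all levels from `1 / ρ v` on. -/
def HasDensity (G : ErasedGraph n) (b : Bool) (δ : ℝ) : Prop :=
  ∃ ρ : Fin n → ℝ, (∀ v, 0 ≤ ρ v ∧ ρ v ≤ 1) ∧
    (∀ (a : ℕ) (v : Fin n), 1 ≤ a * ρ v → G.GoodAt b a v) ∧ δ * n ≤ ∑ v, ρ v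

section Completion

variable {H : SimpleGraph (Fin n)} {L : Fin n → List (Fin n)}

theorem adj_of_some_mem (hL : IsAdjList H L) (hA : Agrees G.adj L) {v w : Fin n}
    (h : some w ∈ G.adj v) : H.Adj v w := by
  obtain ⟨i, hi, hw⟩ := List.mem_iff_getElem.1 h
  have hi' : i < (L v).length := (hA v).length_eq ▸ hi
  have := (hA v).get hi hi' w hw
  exact ((hL v).2 w).1 (this ▸ List.getElem_mem hi')

theorem exists_mem_of_adj (hL : IsAdjList H L) (hA : Agrees G.adj L) {v w : Fin n}
    (h : H.Adj v w) : ∃ x ∈ G.adj v, ∀ u, x = some u → u = w := by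
  obtain ⟨i, hi, hw⟩ := List.mem_iff_getElem.1 (((hL v).2 w).2 h)
  have hi' : i < (G.adj v).length := (hA v).length_eq ▸ hi
  have := (hA v).get hi' hi
  exact ⟨_, List.getElem_mem hi', fun u hu => (this u hu).trans hw⟩

theorem deg_eq (hA : Agrees G.adj L) (v : Fin n) : G.deg v = (L v).length :=
  (hA v).length_eq

end Completion

theorem not_satisfies_connected {C : Finset (Fin n)} (hne : C.Nonempty) (hcard : C.card < n)
    (hC : G.IsClosed C) : ¬ G.Satisfies SimpleGraph.Connected := by
  rintro ⟨H, ⟨L, hL, hA⟩, hH⟩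
  obtain ⟨u, hu⟩ := hne
  obtain ⟨v, -, hv⟩ := Finset.exists_mem_notMem_of_card_lt_card
    (s := C) (t := Finset.univ) (by simpa using hcard)
  obtain ⟨p⟩ := hH.preconnected u v
  refine hv ?_
  clear hv
  induction p with
  | nil => exact hu
  | cons h p ih =>
    obtain ⟨x, hx, hxw⟩ := exists_mem_of_adj hL hA h
    obtain ⟨w, hw, rfl⟩ := hC _ hu x hx
    exact ih (hxw w rfl ▸ hw)

theorem sum_deg : ∑ v, G.deg v = G.numEntries := rfl

/-- A connected completion of a graph on at least two vertices has no isolated vertices. -/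
theorem one_le_avgDegree_of_satisfies (hn : 2 ≤ n) (h : G.Satisfies SimpleGraph.Connected) :
    1 ≤ G.avgDegree := by
  obtain ⟨H, ⟨L, hL, hA⟩, hH⟩ := h
  have : Nontrivial (Fin n) := Fin.nontrivial_iff_two_le.2 hn
  have hdeg : ∀ v, 1 ≤ G.deg v := by
    intro v
    obtain ⟨w, hw⟩ := hH.preconnected.exists_adj_of_nontrivial v
    obtain ⟨x, hx, -⟩ := exists_mem_of_adj hL hA hw
    exact List.length_pos_of_mem hx
  have hsum : n ≤ G.numEntries := by
    have := Finset.sum_le_sum fun v (_ : v ∈ Finset.univ) => hdeg v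
    simpa [sum_deg] using this
  rw [avgDegree, le_div_iff₀ (by positivity), one_mul]
  exact_mod_cast hsum

/-- A graph can be made connected by adding fewer edges than it has components. -/
theorem exists_connected_symmDiff_le (hn : 0 < n) (H : SimpleGraph (Fin n)) :
    ∃ K : SimpleGraph (Fin n), K.Connected ∧
      (symmDiff H.edgeSet K.edgeSet).ncard ≤ Nat.card H.ConnectedComponent := by
  let r : Fin n := ⟨0, hn⟩
  let S : Set (Sym2 (Fin n)) := Set.range fun c : H.ConnectedComponent => s(r, c.out)
  refine ⟨H ⊔ SimpleGraph.fromEdgeSet S, ?_, ?_⟩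
  · have hreach : ∀ v, (H ⊔ SimpleGraph.fromEdgeSet S).Reachable r v := by
      intro v
      have h1 : H.Reachable (H.connectedComponentMk v).out v :=
        SimpleGraph.ConnectedComponent.exact (Quot.out_eq _)
      refine SimpleGraph.Reachable.trans ?_ (h1.mono le_sup_left)
      by_cases h : r = (H.connectedComponentMk v).out
      · rw [← h]
      · refine SimpleGraph.Adj.reachable (SimpleGraph.sup_adj _ _ _ _ |>.2 (.inr ?_))
        exact (SimpleGraph.fromEdgeSet_adj _).2 ⟨⟨_, rfl⟩, h⟩
    have : Nonempty (Fin n) := ⟨r⟩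
    exact ⟨fun u v => (hreach u).symm.trans (hreach v)⟩
  · have hsub : symmDiff H.edgeSet (H ⊔ SimpleGraph.fromEdgeSet S).edgeSet ⊆ S := by
      rw [SimpleGraph.edgeSet_sup, SimpleGraph.edgeSet_fromEdgeSet]
      rintro e (⟨h1, h2⟩ | ⟨h1 | h1, h2⟩)
      · exact absurd (.inl h1) h2
      · exact absurd h1 h2
      · exact h1.1
    refine (Set.ncard_le_ncard hsub (Set.toFinite S)).trans ?_
    rw [← Nat.card_coe_set_eq]
    exact Finite.card_range_le _

open Classical in
/-- The vertices of the component `c`. -/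
noncomputable def verts {H : SimpleGraph (Fin n)} (c : H.ConnectedComponent) : Finset (Fin n) :=
  Finset.univ.filter fun v => H.connectedComponentMk v = c

theorem mem_verts {H : SimpleGraph (Fin n)} {c : H.ConnectedComponent} {v : Fin n} :
    v ∈ verts c ↔ H.connectedComponentMk v = c := by
  simp [verts]

/-- The component `c` has no erased entries. -/
def Clean (G : ErasedGraph n) {H : SimpleGraph (Fin n)} (c : H.ConnectedComponent) : Prop :=
  ∀ v ∈ verts c, none ∉ G.adj v

theorem Clean.isClosed {H : SimpleGraph (Fin n)} {L : Fin n → List (Fin n)}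
    (hL : IsAdjList H L) (hA : Agrees G.adj L) {c : H.ConnectedComponent} (hc : G.Clean c) :
    G.IsClosed (verts c) := by
  intro u hu x hx
  rcases x with _ | w
  · exact absurd hx (hc u hu)
  · refine ⟨w, ?_, rfl⟩
    rw [mem_verts] at hu ⊢
    rw [← hu]
    exact SimpleGraph.ConnectedComponent.sound (adj_of_some_mem hL hA hx).symm.reachable

theorem sum_deg_verts_le {H : SimpleGraph (Fin n)} {L : Fin n → List (Fin n)}
    (hL : IsAdjList H L) (hA : Agrees G.adj L) (c : H.ConnectedComponent) :
    ∑ u ∈ verts c, G.deg u ≤ (verts c).card * (verts c).card := by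
  rw [← smul_eq_mul]
  refine Finset.sum_le_card_nsmul _ _ _ fun u hu => ?_
  rw [deg_eq hA, ← List.toFinset_card_of_nodup (hL u).1]
  refine Finset.card_le_card fun w hw => ?_
  rw [List.mem_toFinset, (hL u).2] at hw
  rw [mem_verts] at hu ⊢
  rw [← hu]
  exact SimpleGraph.ConnectedComponent.sound hw.symm.reachable

open Classical in
/-- Every component that is not clean contains one of the erased entries. -/
theorem card_le_card_clean_add {H : SimpleGraph (Fin n)} :
    Nat.card H.ConnectedComponent ≤
      (Finset.univ.filter fun c : H.ConnectedComponent => G.Clean c).card + G.numErased := by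
  rw [Nat.card_eq_fintype_card, ← Finset.card_univ, ← Finset.card_filter_add_card_filter_not
    (s := Finset.univ) (fun c : H.ConnectedComponent => G.Clean c)]
  refine Nat.add_le_add_left ?_ _
  have h1 : G.numErased = ∑ c : H.ConnectedComponent, ∑ v ∈ verts c, (G.adj v).count none := by
    rw [numErased, ← Finset.sum_fiberwise Finset.univ H.connectedComponentMk]
    rfl
  rw [h1, Finset.card_eq_sum_ones]
  refine (Finset.sum_le_sum fun c hc => ?_).trans
    (Finset.sum_le_sum_of_subset (Finset.filter_subset _ _))
  simp only [Finset.mem_filter, Finset.mem_univ, true_and, Clean, not_forall, not_not] at hc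
  obtain ⟨v, hv, hnone⟩ := hc
  exact (List.count_pos_iff.2 hnone).trans_le
    (Finset.single_le_sum (f := fun v => (G.adj v).count none) (fun _ _ => Nat.zero_le _) hv)

open Classical in
/-- The weights of the vertices of a clean component, which sum up to at least `1`: the reciprocal
of the number of its vertices, or the share of a vertex in its entries. -/
noncomputable def share (G : ErasedGraph n) (H : SimpleGraph (Fin n)) (b : Bool) (v : Fin n) : ℝ :=
  let C := verts (H.connectedComponentMk v)
  if G.Clean (H.connectedComponentMk v) then
    if b then 1 / (C.card : ℝ)
    else if ∑ u ∈ C, G.deg u = 0 then 1 else G.deg v / (∑ u ∈ C, G.deg u : ℕ)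
  else 0

theorem one_le_sum_share {H : SimpleGraph (Fin n)} (b : Bool) {c : H.ConnectedComponent}
    (hc : G.Clean c) : 1 ≤ ∑ v ∈ verts c, G.share H b v := by
  have hne : (verts c).Nonempty := by
    obtain ⟨v, rfl⟩ := c.exists_rep
    exact ⟨v, mem_verts.2 rfl⟩
  have hcard : (0 : ℝ) < (verts c).card := by exact_mod_cast hne.card_pos
  cases b
  · by_cases h0 : ∑ u ∈ verts c, G.deg u = 0
    · have : ∑ v ∈ verts c, G.share H false v = ∑ v ∈ verts c, 1 := by
        refine Finset.sum_congr rfl fun v hv => ?_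
        rw [mem_verts] at hv
        simp only [share, hv, hc, h0]
        simp
      rw [this]
      simpa using hne
    · have : ∑ v ∈ verts c, G.share H false v =
          ∑ v ∈ verts c, (G.deg v : ℝ) / (∑ u ∈ verts c, G.deg u : ℕ) := by
        refine Finset.sum_congr rfl fun v hv => ?_
        rw [mem_verts] at hv
        simp only [share, hv, hc, h0]
        simp
      rw [this, ← Finset.sum_div, ← Nat.cast_sum, div_self (by exact_mod_cast h0)]
  · have : ∑ v ∈ verts c, G.share H true v = ∑ v ∈ verts c, 1 / ((verts c).card : ℝ) := by
      refine Finset.sum_congr rfl fun v hv => ?_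
      rw [mem_verts] at hv
      simp only [share, hv, hc]
      simp
    rw [this, Finset.sum_const, nsmul_eq_mul, mul_one_div, div_self hcard.ne']

theorem share_nonneg_le_one (H : SimpleGraph (Fin n)) (b : Bool) (v : Fin n) :
    0 ≤ G.share H b v ∧ G.share H b v ≤ 1 := by
  have hv : v ∈ verts (H.connectedComponentMk v) := mem_verts.2 rfl
  have hcard : (1 : ℝ) ≤ (verts (H.connectedComponentMk v)).card := by
    exact_mod_cast Finset.card_pos.2 ⟨v, hv⟩
  have hdeg : (G.deg v : ℝ) ≤ (∑ u ∈ verts (H.connectedComponentMk v), G.deg u : ℕ) := by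
    exact_mod_cast Finset.single_le_sum (f := G.deg) (fun _ _ => Nat.zero_le _) hv
  simp only [share]
  split_ifs
  · exact ⟨by positivity, div_le_one_of_le₀ hcard (by positivity)⟩
  · exact ⟨zero_le_one, le_rfl⟩
  · exact ⟨by positivity, div_le_one_of_le₀ hdeg (by positivity)⟩
  · exact ⟨le_rfl, zero_le_one⟩

theorem goodAt_of_share {H : SimpleGraph (Fin n)} {L : Fin n → List (Fin n)}
    (hL : IsAdjList H L) (hA : Agrees G.adj L) (hH : ¬ H.Connected) {b : Bool}
    {a : ℕ} {v : Fin n} (h : 1 ≤ a * G.share H b v) : G.GoodAt b a v := by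
  have hv : v ∈ verts (H.connectedComponentMk v) := mem_verts.2 rfl
  have hcard : (0 : ℝ) < (verts (H.connectedComponentMk v)).card := by
    exact_mod_cast Finset.card_pos.2 ⟨v, hv⟩
  by_cases hc : G.Clean (H.connectedComponentMk v)
  · refine ⟨verts (H.connectedComponentMk v), hv, ?_, hc.isClosed hL hA, ?_⟩
    · by_contra hlt
      have huniv : verts (H.connectedComponentMk v) = Finset.univ := by
        rw [← Finset.card_eq_iff_eq_univ, Fintype.card_fin]
        exact le_antisymm (by simpa using Finset.card_le_univ (verts (H.connectedComponentMk v)))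
          (not_lt.1 hlt)
      have : Nonempty (Fin n) := ⟨v⟩
      refine hH ⟨fun x y => SimpleGraph.ConnectedComponent.exact ?_⟩
      have hm : ∀ z, H.connectedComponentMk z = H.connectedComponentMk v := fun z =>
        mem_verts.1 (huniv ▸ Finset.mem_univ z)
      rw [hm x, hm y]
    · simp only [share, if_pos hc] at h
      split_ifs at h with h1 h2
      · rw [mul_one_div, one_le_div hcard] at h
        have h' : (verts (H.connectedComponentMk v)).card ≤ a := by exact_mod_cast h
        simp only [weight, h1, if_true]
        exact (sum_deg_verts_le hL hA _).trans (Nat.mul_le_mul h' h')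
      · rw [h2]; exact Nat.zero_le _
      · have h2' : (0 : ℝ) < (∑ u ∈ verts (H.connectedComponentMk v), G.deg u : ℕ) := by
          exact_mod_cast Nat.pos_of_ne_zero h2
        rw [mul_div_assoc', one_le_div h2'] at h
        simp only [weight, h1]
        exact_mod_cast h
  · simp only [share, if_neg hc, mul_zero] at h
    exact absurd h (by norm_num)

/-- A graph that is far from connected has many clean components. -/
theorem hasDensity_of_isFar (hn : 2 ≤ n) {ε α : ℝ} (hε : 0 < ε) (hα : G.IsErased α)
    (hfar : G.IsFar ε SimpleGraph.Connected) (b : Bool) :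
    G.HasDensity b ((ε - 2 * α) * G.avgDegree / 2) := by
  classical
  obtain ⟨H, L, hL, hA⟩ := G.valid
  have hn0 : (0 : ℝ) < n := by exact_mod_cast (by omega : 0 < n)
  have hH : ¬ H.Connected := by
    intro hH
    have h1 := one_le_avgDegree_of_satisfies hn ⟨H, ⟨L, hL, hA⟩, hH⟩
    have h2 := hfar H ⟨L, hL, hA⟩ H hH
    rw [symmDiff_self] at h2
    rw [avgDegree, le_div_iff₀ hn0] at h1
    have h3 : (0 : ℝ) < G.numEntries := by linarith
    have h4 : 0 < ε * G.numEdges := mul_pos hε (by rw [numEdges]; positivity)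
    simp at h2
    linarith
  refine ⟨G.share H b, share_nonneg_le_one H b,
    fun a v h => goodAt_of_share hL hA hH h, ?_⟩
  obtain ⟨K, hK, hcard⟩ := exists_connected_symmDiff_le (by omega) H
  have h1 := hfar H ⟨L, hL, hA⟩ K hK
  have h2 := card_le_card_clean_add (G := G) (H := H)
  have h3 : ((Finset.univ.filter fun c : H.ConnectedComponent => G.Clean c).card : ℝ) ≤
      ∑ v, G.share H b v := by
    rw [← Finset.sum_fiberwise Finset.univ H.connectedComponentMk, Finset.card_eq_sum_ones,
      Nat.cast_sum]
    refine (Finset.sum_le_sum fun c hc => ?_).trans (Finset.sum_le_sum_of_subset_of_nonneg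
      (Finset.filter_subset _ _)
      fun c _ _ => Finset.sum_nonneg fun v _ => (share_nonneg_le_one H b v).1)
    rw [Nat.cast_one]
    exact one_le_sum_share b (Finset.mem_filter.1 hc).2
  have h4 : ((symmDiff H.edgeSet K.edgeSet).ncard : ℝ) ≤
      (Finset.univ.filter fun c : H.ConnectedComponent => G.Clean c).card + G.numErased := by
    exact_mod_cast hcard.trans h2
  have h5 : (ε - 2 * α) * G.avgDegree / 2 * n = ε * G.numEdges - α * G.numEntries := by
    rw [avgDegree, numEdges]
    field_simp
  rw [IsErased] at hα
  rw [h5]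
  linarith

/-- If the average degree is small, then a trial of any level succeeds from many vertices. -/
theorem hasDensity_of_avgDegree_le (hn : 2 ≤ n) (hd : G.avgDegree ≤ 1 / 2) (b : Bool) :
    G.HasDensity b (1 / 2) := by
  classical
  have hn0 : (0 : ℝ) < n := by exact_mod_cast (by omega : 0 < n)
  refine ⟨fun v => if G.deg v = 0 then 1 else 0, fun v => ?_, fun a v h => ?_, ?_⟩
  · dsimp only
    split_ifs <;> norm_num
  · dsimp only at h
    split_ifs at h with h0
    · have h0' : G.adj v = [] := List.length_eq_zero_iff.1 h0
      refine ⟨{v}, by simp, by simpa using by omega, ?_, by simp [h0]⟩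
      intro u hu x hx
      rw [Finset.mem_singleton.1 hu, h0'] at hx
      simp at hx
    · norm_num at h
  · have h1 : ∀ v, (1 : ℝ) - G.deg v ≤ if G.deg v = 0 then 1 else 0 := by
      intro v
      split_ifs with h
      · simp
      · have : (1 : ℝ) ≤ G.deg v := by exact_mod_cast Nat.one_le_iff_ne_zero.2 h
        linarith
    have h2 := Finset.sum_le_sum fun v (_ : v ∈ Finset.univ) => h1 v
    rw [Finset.sum_sub_distrib, ← Nat.cast_sum, sum_deg] at h2
    rw [avgDegree, div_le_iff₀ hn0] at hd
    simp only [Finset.sum_const, Finset.card_univ, Fintype.card_fin, nsmul_eq_mul, mul_one] at h2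
    linarith

end ErasedGraph

/-! ### The success probability of the search -/

/-- The remaining `m + 1` trials of a level `a` of phase `N`, and the slot that follows them. -/
theorem slot_add {N a k : ℕ} {t m : ℕ} (hs : slot t = ⟨N, a, k⟩) (hm : k + (m + 1) * a = N)
    (ha : 0 < a) :
    slot (t + (m + 1)) = (if N < a + a then ⟨N + N, 1, 0⟩ else ⟨N, a + a, 0⟩) ∧
      ∀ f : ℕ → ℝ, ∑ i ∈ Finset.range (t + (m + 1)), f (slot i).level =
        ∑ i ∈ Finset.range t, f (slot i).level + (m + 1 : ℕ) * f a := by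
  induction m generalizing t k with
  | zero =>
    refine ⟨?_, fun f => ?_⟩
    · change (slot t).next = _
      rw [hs, Slot.next, if_neg (by dsimp only; omega)]
    · rw [zero_add, Finset.sum_range_succ, hs]
      simp
  | succ m ih =>
    have h1 : slot (t + 1) = ⟨N, a, k + a⟩ := by
      change (slot t).next = _
      have : 0 < (m + 1) * a := by positivity
      have h2 : (m + 1 + 1) * a = (m + 1) * a + a := by ring
      rw [hs, Slot.next, if_pos (by dsimp only; omega)]
    obtain ⟨h2, h3⟩ := ih h1 (by rw [← hm]; ring)
    rw [show t + (m + 1 + 1) = t + 1 + (m + 1) by ring]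
    refine ⟨h2, fun f => ?_⟩
    rw [h3, Finset.sum_range_succ, hs]
    push_cast
    ring

/-- Level `2 ^ i` of phase `2 ^ j` begins after some number `R` of trials; sums over these trials are
grouped by phase and level. -/
theorem exists_slot_eq (j i : ℕ) (hi : i ≤ j) :
    ∃ R, slot R = ⟨2 ^ j, 2 ^ i, 0⟩ ∧ ∀ f : ℕ → ℝ,
      ∑ t ∈ Finset.range R, f (slot t).level =
        ∑ j' ∈ Finset.range j, ∑ i' ∈ Finset.range (j' + 1), (2 : ℝ) ^ (j' - i') * f (2 ^ i') +
          ∑ i' ∈ Finset.range i, (2 : ℝ) ^ (j - i') * f (2 ^ i') := by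
  have level : ∀ j i R, i ≤ j → slot R = ⟨2 ^ j, 2 ^ i, 0⟩ → ∃ R',
      slot R' = (if 2 ^ j < 2 ^ i + 2 ^ i then ⟨2 ^ j + 2 ^ j, 1, 0⟩
        else ⟨2 ^ j, 2 ^ i + 2 ^ i, 0⟩) ∧
      ∀ f : ℕ → ℝ, ∑ t ∈ Finset.range R', f (slot t).level =
        ∑ t ∈ Finset.range R, f (slot t).level + (2 : ℝ) ^ (j - i) * f (2 ^ i) := by
    intro j i R hi hR
    have h1 : 2 ^ (j - i) - 1 + 1 = 2 ^ (j - i) := Nat.sub_add_cancel Nat.one_le_two_pow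
    obtain ⟨h2, h3⟩ := slot_add (m := 2 ^ (j - i) - 1) hR
      (by rw [h1, zero_add, ← pow_add, Nat.sub_add_cancel hi]) (by positivity)
    refine ⟨_, h2, fun f => ?_⟩
    rw [h3, h1]
    push_cast
    rfl
  induction j generalizing i with
  | zero =>
    obtain rfl : i = 0 := by omega
    exact ⟨0, rfl, by simp⟩
  | succ j ihj =>
    induction i with
    | zero =>
      obtain ⟨R, hR, hsum⟩ := ihj j le_rfl
      obtain ⟨R', hR', hsum'⟩ := level j j R le_rfl hR
      refine ⟨R', ?_, fun f => ?_⟩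
      · rw [hR', if_pos (by have : 0 < 2 ^ j := by positivity
                            omega), pow_succ, mul_two, pow_zero]
      · rw [hsum', hsum, Finset.sum_range_succ _ j, Finset.sum_range_succ _ j]
        simp only [Finset.range_zero, Finset.sum_empty, add_zero]
        ring
    | succ i ihi =>
      obtain ⟨R, hR, hsum⟩ := ihi (by omega)
      obtain ⟨R', hR', hsum'⟩ := level (j + 1) i R (by omega) hR
      have hpow : 2 ^ i + 2 ^ i ≤ 2 ^ (j + 1) := by
        rw [← mul_two, ← pow_succ]
        exact Nat.pow_le_pow_right (by norm_num) hi
      refine ⟨R', ?_, fun f => ?_⟩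
      · rw [hR', if_neg (by omega), pow_succ 2 i, mul_two]
      · rw [hsum', hsum, Finset.sum_range_succ _ i]
        ring

/-- The trials of the phases `2 ^ 0, …, 2 ^ J`, grouped by phase and level. -/
theorem exists_sum_slot (J : ℕ) : ∃ R, ∀ f : ℕ → ℝ,
    ∑ t ∈ Finset.range R, f (slot t).level =
      ∑ j ∈ Finset.range (J + 1), ∑ i ∈ Finset.range (j + 1), (2 : ℝ) ^ (j - i) * f (2 ^ i) := by
  obtain ⟨R, -, h⟩ := exists_slot_eq (J + 1) 0 (Nat.zero_le _)
  exact ⟨R, fun f => by simpa using h f⟩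

/-- Half of a weight `r ≤ 1` is recovered from the levels `2 ^ i ≥ 1 / r`, up to the loss that is due
to stopping at the level `2 ^ J`. -/
theorem half_le_sum_levels {r : ℝ} (hr : r ≤ 1) (J : ℕ) (P : ℕ → Prop) [DecidablePred P]
    (hP : ∀ i, 1 ≤ (2 : ℝ) ^ i * r → P i) :
    (2 ^ J * r - 1) / 2 ≤
      ∑ i ∈ Finset.range (J + 1), (2 : ℝ) ^ (J - i) * (if P i then 1 else 0) := by
  have hnn : ∀ i ∈ Finset.range (J + 1), 0 ≤ (2 : ℝ) ^ (J - i) * (if P i then 1 else 0) := by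
    intro i _
    split_ifs <;> simp
  by_cases hJ : 1 ≤ (2 : ℝ) ^ J * r
  · have hex : ∃ i, 1 ≤ (2 : ℝ) ^ i * r := ⟨J, hJ⟩
    classical
    set i₀ := Nat.find hex with hi₀
    have h1 : 1 ≤ (2 : ℝ) ^ i₀ * r := Nat.find_spec hex
    have h2 : i₀ ≤ J := Nat.find_min' hex hJ
    have h3 := Finset.single_le_sum hnn (Finset.mem_range.2 (Nat.lt_succ_of_le h2))
    simp only [if_pos (hP i₀ h1), mul_one] at h3
    refine le_trans ?_ h3
    rcases Nat.eq_zero_or_pos i₀ with h0 | h0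
    · rw [h0, Nat.sub_zero]
      nlinarith [show (0 : ℝ) < 2 ^ J by positivity]
    · have h4 : (2 : ℝ) ^ (i₀ - 1) * r < 1 := not_le.1 (Nat.find_min hex (by omega))
      have h5 : (2 : ℝ) ^ J = 2 * (2 ^ (J - i₀) * 2 ^ (i₀ - 1)) := by
        rw [← pow_add, ← pow_succ']
        congr 1
        omega
      have h6 : (0 : ℝ) < 2 ^ (J - i₀) := by positivity
      rw [h5]
      nlinarith
  · exact le_trans (by linarith) (Finset.sum_nonneg hnn)

namespace ErasedGraph

variable {n : ℕ} (G : ErasedGraph n)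

/-- The expected value of the total of the initial potentials of the trials in the phases
`2 ^ 0, …, 2 ^ J`, a bound on the expected number of their steps. -/
noncomputable def expectedCost (b : Bool) (J : ℕ) : ℝ :=
  ∑ j ∈ Finset.range (J + 1), ∑ i ∈ Finset.range (j + 1), (2 : ℝ) ^ (j - i) *
    (2 * (2 ^ i * ((∑ v, (G.weight b (2 ^ i) v : ℝ)) / n)) + 1)

open Classical in
/-- The probability that a trial at level `a` succeeds. -/
noncomputable def goodProb (b : Bool) (a : ℕ) : ℝ :=
  ((Finset.univ.filter fun v => G.GoodAt b a v).card : ℝ) / n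

variable {G}

/-- The expected number of successful trials in the phases up to `5 / δ` is at least `2`. -/
theorem two_le_sum_goodProb [NeZero n] {b : Bool} {δ : ℝ} (h : G.HasDensity b δ) {J : ℕ}
    (hJ : 5 ≤ 2 ^ J * δ) :
    2 ≤ ∑ j ∈ Finset.range (J + 1), ∑ i ∈ Finset.range (j + 1),
      (2 : ℝ) ^ (j - i) * G.goodProb b (2 ^ i) := by
  classical
  obtain ⟨ρ, h01, hgood, hsum⟩ := h
  have hn : (0 : ℝ) < n := by exact_mod_cast Nat.pos_of_ne_zero (NeZero.ne n)
  have hnn : ∀ a, 0 ≤ G.goodProb b a := fun a => by unfold goodProb; positivity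
  -- the last phase suffices
  refine le_trans ?_ (Finset.single_le_sum (f := fun j => ∑ i ∈ Finset.range (j + 1),
    (2 : ℝ) ^ (j - i) * G.goodProb b (2 ^ i))
    (fun j _ => Finset.sum_nonneg fun i _ => mul_nonneg (by positivity) (hnn _))
    (Finset.mem_range.2 (Nat.lt_succ_self J)))
  have h1 : ∑ i ∈ Finset.range (J + 1), (2 : ℝ) ^ (J - i) * G.goodProb b (2 ^ i) =
      (∑ v, ∑ i ∈ Finset.range (J + 1),
        (2 : ℝ) ^ (J - i) * (if G.GoodAt b (2 ^ i) v then 1 else 0)) / n := by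
    rw [Finset.sum_comm, Finset.sum_div]
    refine Finset.sum_congr rfl fun i _ => ?_
    rw [goodProb, ← Finset.mul_sum, Finset.sum_boole, mul_div_assoc]
  rw [h1, le_div_iff₀ hn]
  have h2 := Finset.sum_le_sum fun v (_ : v ∈ Finset.univ) =>
    half_le_sum_levels (h01 v).2 J (fun i => G.GoodAt b (2 ^ i) v)
      fun i hi => hgood _ _ (by exact_mod_cast hi)
  refine le_trans ?_ h2
  rw [← Finset.sum_div, Finset.sum_sub_distrib, ← Finset.mul_sum]
  simp only [Finset.sum_const, Finset.card_univ, Fintype.card_fin, nsmul_eq_mul, mul_one]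
  have h3 : (2 : ℝ) ^ J * (δ * n) ≤ 2 ^ J * ∑ v, ρ v :=
    mul_le_mul_of_nonneg_left hsum (by positivity)
  nlinarith

end ErasedGraph

section Probability

variable {n : ℕ} [NeZero n]

instance : IsProbabilityMeasure (randomVertices n) := by
  unfold randomVertices; infer_instance

theorem integrable_eval_randomVertices (g : Fin n → ℝ) (t : ℕ) :
    Integrable (fun ω : ℕ → Fin n => g (ω t)) (randomVertices n) :=
  (measurePreserving_eval_infinitePi (fun _ : ℕ => (PMF.uniformOfFintype (Fin n)).toMeasure)
    t).integrable_comp_of_integrable Integrable.of_finite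

theorem integral_eval_randomVertices (g : Fin n → ℝ) (t : ℕ) :
    ∫ ω, g (ω t) ∂(randomVertices n) = (∑ v, g v) / n := by
  have h := (measurePreserving_eval_infinitePi
    (fun _ : ℕ => (PMF.uniformOfFintype (Fin n)).toMeasure) t).map_eq
  have h1 : ∫ ω, g (ω t) ∂(randomVertices n) =
      ∫ v, g v ∂(PMF.uniformOfFintype (Fin n)).toMeasure := by
    rw [← h, integral_map (measurable_pi_apply t).aemeasurable (by fun_prop)]
    rfl
  rw [h1, PMF.integral_eq_sum, Finset.sum_div]
  refine Finset.sum_congr rfl fun v _ => ?_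
  simp [div_eq_inv_mul]

/-- The probability that all of the first `R` vertices miss given sets. -/
theorem measureReal_forall_notMem_le (S : ℕ → Finset (Fin n)) (R : ℕ) :
    (randomVertices n).real {ω | ∀ t < R, ω t ∉ S t} ≤
      Real.exp (-∑ t ∈ Finset.range R, ((S t).card : ℝ) / n) := by
  have h1 : {ω : ℕ → Fin n | ∀ t < R, ω t ∉ S t} =
      Set.pi (Finset.range R : Set ℕ) fun t => (S t : Set (Fin n))ᶜ := by
    ext ω; simp
  rw [h1, measureReal_def, randomVertices, Measure.infinitePi_pi _ fun _ _ => .of_discrete,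
    ENNReal.toReal_prod, ← Finset.sum_neg_distrib, Real.exp_sum]
  refine Finset.prod_le_prod (fun _ _ => ENNReal.toReal_nonneg) fun t _ => ?_
  rw [← measureReal_def, probReal_compl_eq_one_sub .of_discrete, measureReal_def,
    PMF.toMeasure_uniformOfFintype_apply _ .of_discrete]
  have := Real.add_one_le_exp (-(((S t).card : ℝ) / n))
  simp
  linarith

/-- If the graph has density `δ`, then with a budget of six times the expected cost of the phases
up to `5 / δ` the search finds a proper closed set with probability at least `2 / 3`: it runs out
of its budget with probability at most `1 / 6`, and the trials in these phases all fail with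
probability at most `exp (-2)`. -/
theorem two_thirds_le_finds {G : ErasedGraph n} {b : Bool} {δ : ℝ} (h : G.HasDensity b δ) {J : ℕ}
    (hJ : 5 ≤ 2 ^ J * δ) {W : ℝ} (hW : 6 * G.expectedCost b J ≤ W) (hW0 : 0 < W) :
    2 / 3 ≤ randomVertices n
      {ω | ∃ j : ℕ, (j : ℝ) ≤ W ∧ Search.Finds G ω b j (Search.start G ω b 0)} := by
  classical
  obtain ⟨R, hR⟩ := exists_sum_slot J
  set S := {ω : ℕ → Fin n | ∃ j : ℕ, (j : ℝ) ≤ W ∧ Search.Finds G ω b j (Search.start G ω b 0)}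
  let good : ℕ → Finset (Fin n) := fun t =>
    Finset.univ.filter fun v => G.GoodAt b (slot t).level v
  let cost : ℕ → Fin n → ℝ := fun t v =>
    2 * ((slot t).level * G.weight b (slot t).level v) + 1
  let A := {ω : ℕ → Fin n | ∀ t < R, ω t ∉ good t}
  let B := {ω : ℕ → Fin n | W ≤ ∑ t ∈ Finset.range R, cost t (ω t)}
  have hcover : Set.univ ⊆ S ∪ (A ∪ B) := by
    intro ω _
    by_cases hA : ω ∈ A
    · exact .inr (.inl hA)
    by_cases hB : ω ∈ B
    · exact .inr (.inr hB)
    left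
    simp only [A, Set.mem_ofPred_eq, not_forall, not_not] at hA
    obtain ⟨t, ht, hg⟩ := hA
    refine ⟨_, ?_, Search.finds_of_goodAt ht (Finset.mem_filter.1 hg).2⟩
    refine le_trans (le_of_eq ?_) (not_le.1 hB).le
    rw [Nat.cast_sum]
    refine Finset.sum_congr rfl fun t _ => ?_
    rw [Search.potential_start]
    push_cast
    rfl
  have hAle : (randomVertices n).real A ≤ 1 / 6 := by
    refine (measureReal_forall_notMem_le good R).trans ?_
    have h2 : 2 ≤ ∑ t ∈ Finset.range R, ((good t).card : ℝ) / n := by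
      have h3 := ErasedGraph.two_le_sum_goodProb h hJ
      rw [← hR (G.goodProb b)] at h3
      exact h3
    rw [Real.exp_neg, one_div]
    refine inv_anti₀ (by norm_num) ?_
    have h3 : (6 : ℝ) ≤ Real.exp 1 * Real.exp 1 := by nlinarith [Real.exp_one_gt_d9]
    rw [← Real.exp_add] at h3
    exact h3.trans (Real.exp_le_exp.2 (by linarith))
  have hBle : (randomVertices n).real B ≤ 1 / 6 := by
    have hcost : ∀ t v, 0 ≤ cost t v := fun t v => by simp only [cost]; positivity
    have h1 := mul_meas_ge_le_integral_of_nonneg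
      (f := fun ω : ℕ → Fin n => ∑ t ∈ Finset.range R, cost t (ω t)) (μ := randomVertices n)
      (.of_forall fun ω => Finset.sum_nonneg fun t _ => hcost t _)
      (integrable_finsetSum _ fun t _ => integrable_eval_randomVertices (cost t) t) W
    rw [integral_finsetSum _ fun t _ => integrable_eval_randomVertices (cost t) t] at h1
    simp only [integral_eval_randomVertices] at h1
    have h2 : ∑ t ∈ Finset.range R, (∑ v, cost t v) / n = G.expectedCost b J := by
      rw [ErasedGraph.expectedCost, hR fun a => (∑ v, (2 * ((a : ℝ) * G.weight b a v) + 1)) / n]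
      refine Finset.sum_congr rfl fun j _ => Finset.sum_congr rfl fun i _ => ?_
      have hn : (n : ℝ) ≠ 0 := by exact_mod_cast NeZero.ne n
      rw [Finset.sum_add_distrib, ← Finset.mul_sum, ← Finset.mul_sum]
      simp only [Finset.sum_const, Finset.card_univ, Fintype.card_fin, nsmul_eq_mul, mul_one]
      push_cast
      field_simp
    rw [h2] at h1
    have h3 : W * (randomVertices n).real B ≤ W * (1 / 6) := by linarith
    exact le_of_mul_le_mul_left h3 hW0
  have hfinal : 2 / 3 ≤ (randomVertices n).real S := by
    have h1 := measureReal_mono hcover (measure_ne_top (randomVertices n) _)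
    have h2 := measureReal_union_le (μ := randomVertices n) S (A ∪ B)
    have h3 := measureReal_union_le (μ := randomVertices n) A B
    rw [probReal_univ] at h1
    linarith
  have h23 : (2 / 3 : ENNReal) = ENNReal.ofReal (2 / 3) := by
    rw [ENNReal.ofReal_div_of_pos (by norm_num)]
    norm_num
  rw [h23]
  exact ENNReal.ofReal_le_of_le_toReal hfinal

end Probability

/-! ### Bounds for the expected cost -/

theorem sum_two_pow_sub_le (j : ℕ) :
    ∑ i ∈ Finset.range (j + 1), (2 : ℝ) ^ (j - i) ≤ 2 * 2 ^ j := by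
  have h := Finset.sum_range_reflect (fun i => (2 : ℝ) ^ i) (j + 1)
  simp only [Nat.add_sub_cancel] at h
  rw [h, geom_sum_eq (by norm_num), pow_succ]
  norm_num
  linarith

theorem sum_two_pow_le (j : ℕ) : ∑ i ∈ Finset.range (j + 1), (2 : ℝ) ^ i ≤ 2 * 2 ^ j := by
  rw [geom_sum_eq (by norm_num), pow_succ]
  norm_num
  linarith

namespace ErasedGraph

variable {n : ℕ} (G : ErasedGraph n)

theorem avgDegree_nonneg : 0 ≤ G.avgDegree := by unfold avgDegree; positivity

theorem expectedCost_false_le (J : ℕ) :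
    6 * G.expectedCost false J ≤ 24 * 2 ^ J * ((J + 1) * G.avgDegree + 1) := by
  have hd := G.avgDegree_nonneg
  have havg : (∑ v, (G.deg v : ℝ)) / n = G.avgDegree := by
    rw [avgDegree, ← sum_deg, Nat.cast_sum]
  have h1 : G.expectedCost false J ≤
      ∑ j ∈ Finset.range (J + 1), 2 ^ j * (2 * (J + 1) * G.avgDegree + 2) := by
    refine Finset.sum_le_sum fun j hj => ?_
    have hj' : (j : ℝ) ≤ J := by exact_mod_cast Nat.lt_succ_iff.1 (Finset.mem_range.1 hj)
    have h2 : ∀ i ∈ Finset.range (j + 1), (2 : ℝ) ^ (j - i) *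
        (2 * (2 ^ i * ((∑ v, (G.weight false (2 ^ i) v : ℝ)) / n)) + 1) =
        2 ^ j * (2 * G.avgDegree) + 2 ^ (j - i) := by
      intro i hi
      have h3 : (2 : ℝ) ^ j = 2 ^ (j - i) * 2 ^ i := by
        rw [← pow_add, Nat.sub_add_cancel (Nat.lt_succ_iff.1 (Finset.mem_range.1 hi))]
      simp only [weight, Bool.false_eq_true, if_false, havg, h3]
      ring
    rw [Finset.sum_congr rfl h2, Finset.sum_add_distrib, Finset.sum_const, Finset.card_range,
      nsmul_eq_mul]
    have h4 := sum_two_pow_sub_le j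
    have h5 : (0 : ℝ) ≤ 2 ^ j * (2 * G.avgDegree) := by positivity
    push_cast
    nlinarith
  rw [← Finset.sum_mul] at h1
  have h6 := mul_le_mul_of_nonneg_right (sum_two_pow_le J)
    (show 0 ≤ 2 * ((J : ℝ) + 1) * G.avgDegree + 2 by positivity)
  linarith

theorem expectedCost_true_le [NeZero n] (J : ℕ) :
    6 * G.expectedCost true J ≤ 48 * (2 ^ J * 2 ^ J) := by
  have hn : (n : ℝ) ≠ 0 := by exact_mod_cast NeZero.ne n
  have h1 : G.expectedCost true J ≤ ∑ j ∈ Finset.range (J + 1), 6 * 4 ^ j := by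
    refine Finset.sum_le_sum fun j _ => ?_
    have h2 : ∀ i ∈ Finset.range (j + 1), (2 : ℝ) ^ (j - i) *
        (2 * (2 ^ i * ((∑ v, (G.weight true (2 ^ i) v : ℝ)) / n)) + 1) =
        2 * 2 ^ j * 2 ^ i + 2 ^ (j - i) := by
      intro i hi
      have h3 : (2 : ℝ) ^ j = 2 ^ (j - i) * 2 ^ i := by
        rw [← pow_add, Nat.sub_add_cancel (Nat.lt_succ_iff.1 (Finset.mem_range.1 hi))]
      simp only [weight, if_true, Finset.sum_const, Finset.card_univ, Fintype.card_fin,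
        nsmul_eq_mul, h3]
      push_cast
      rw [mul_div_cancel_left₀ _ hn]
      ring
    rw [Finset.sum_congr rfl h2, Finset.sum_add_distrib, ← Finset.mul_sum]
    have h4 := sum_two_pow_sub_le j
    have h5 := mul_le_mul_of_nonneg_left (sum_two_pow_le j)
      (show (0 : ℝ) ≤ 2 * 2 ^ j by positivity)
    have h6 : (4 : ℝ) ^ j = 2 ^ j * 2 ^ j := by rw [← mul_pow]; norm_num
    have h7 : (1 : ℝ) ≤ 2 ^ j := one_le_pow₀ (by norm_num)
    rw [h6]
    nlinarith
  rw [← Finset.mul_sum, geom_sum_eq (by norm_num), pow_succ] at h1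
  have h6 : (4 : ℝ) ^ J = 2 ^ J * 2 ^ J := by rw [← mul_pow]; norm_num
  rw [← h6]
  norm_num at h1
  linarith

theorem two_le_of_avgDegree_pos (h : 0 < G.avgDegree) : 2 ≤ n := by
  by_contra hn
  obtain ⟨H, L, hL, hA⟩ := G.valid
  have h0 : ∀ v, G.deg v = 0 := by
    intro v
    rw [deg_eq hA, List.length_eq_zero_iff, List.eq_nil_iff_forall_not_mem]
    intro w hw
    have := (((hL v).2 w).1 hw).ne
    exact this (Fin.ext (by omega))
  rw [avgDegree, ← sum_deg] at h
  simp [h0] at h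

end ErasedGraph

/-! ### The complete programs -/

/-- The search with the budget in the real register `3`, from its first trial on. -/
def runProg (b : Bool) : Prog :=
  .pre [.const 0 1, .const 3 1, .const 4 1, .const 5 1, .rconst 5 1]
    (.seq (startProg b) (searchProg b))

/-- The registers and cells that are not used by the computation of the budget. -/
structure Fresh (n : ℕ) (s : State) : Prop where
  vertices : s.reg 1 = n
  used : s.reg 6 = 0
  trial : s.reg 7 = 0
  rzero : s.real 4 = 0
  drawn : s.drawn = 0
  mem : ∀ a, s.mem a = 0

/-- The program `p` reduces to the search in mode `b` with budget `W`, after at most `T` steps. -/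
def Prepares {n : ℕ} (p : Prog) (b : Bool) (x y z : ℝ) (G : ErasedGraph n) (W : ℝ) (T : ℕ) :
    Prop :=
  ∀ ω : ℕ → Fin n, ∃ s, Fresh n s ∧ s.real 3 = W ∧ s.time ≤ T ∧ s.queries ≤ T ∧
    ∀ s', Exec G ω (runProg b) s s' → Exec G ω p (State.initial n x y z) s'

section Run

variable {n : ℕ} {G : ErasedGraph n} {b : Bool}

theorem Fresh.exists_represents {s : State} (h : Fresh n s) (ω : ℕ → Fin n) :
    ∃ s₁, Represents s₁ (Search.start G ω b 0) ∧ s₁.real 3 = s.real 3 ∧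
      s₁.time ≤ s.time + 25 ∧ s₁.queries ≤ s.queries + 25 ∧
      ∀ s', Exec G ω (searchProg b) s₁ s' → Exec G ω (runProg b) s s' := by
  obtain ⟨h1, h6, h7, hr, hd, hm⟩ := h
  let s₀ := (Prog.pre [.const 0 1, .const 3 1, .const 4 1, .const 5 1]
    (.op (.rconst 5 1))).eval G ω s
  have h0 : Ready n 0 s₀ := by
    constructor <;>
      simp [s₀, Prog.pre, Prog.eval, Instr.run, State.tick, State.setReg, State.setReal, h1, h6,
        h7, hr, hd, hm, slot]
  have h3 : s₀.real 3 = s.real 3 := by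
    simp [s₀, Prog.pre, Prog.eval, Instr.run, State.tick, State.setReg, State.setReal]
  obtain ⟨ht, hq⟩ := (Prog.pre [.const 0 1, .const 3 1, .const 4 1, .const 5 1]
    (.op (.rconst 5 1))).eval_time_queries G ω s
  obtain ⟨ht', hq'⟩ := (startProg b).eval_time_queries G ω s₀
  rw [size_startProg] at ht' hq'
  simp only [Prog.pre, Prog.size] at ht hq
  have he := h0.eval_startProg (G := G) (ω := ω) (b := b)
  refine ⟨_, he.1, he.2.trans h3, ?_, ?_, fun s' h => ?_⟩
  · refine ht'.trans ?_
    change (Prog.eval _ _ _ _).time + _ ≤ _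
    simp only [Prog.pre]
    omega
  · refine hq'.trans ?_
    change (Prog.eval _ _ _ _).queries + _ ≤ _
    simp only [Prog.pre]
    omega
  · exact .seq (.op _ _) <| .seq (.op _ _) <| .seq (.op _ _) <| .seq (.op _ _) <|
      .seq (.op _ _) <| .seq ((loopFree_startProg b).exec G ω s₀) h

variable {p : Prog} {x y z W : ℝ} {T : ℕ}

theorem Prepares.accepts (h : Prepares p b x y z G W T)
    (hG : G.Satisfies SimpleGraph.Connected) (ω : ℕ → Fin n) : Accepts p x y z G ω := by
  obtain ⟨s, hf, -, -, -, hp⟩ := h ω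
  obtain ⟨s₁, hr, -, -, -, hs⟩ := hf.exists_represents (G := G) (b := b) ω
  obtain ⟨s', he, hsound, -⟩ := hr.exec_searchProg (b := b) (ω := ω) (Search.sound_start 0)
  refine ⟨s', hp _ (hs _ he), fun h0 => ?_⟩
  obtain ⟨C, hne, hcard, hC⟩ := hsound h0
  exact ErasedGraph.not_satisfies_connected hne hcard hC hG

theorem Prepares.two_thirds_le_rejects [NeZero n] (h : Prepares p b x y z G W T) {δ : ℝ}
    (hδ : G.HasDensity b δ) {J : ℕ} (hJ : 5 ≤ 2 ^ J * δ) (hW : 6 * G.expectedCost b J ≤ W)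
    (hW0 : 0 < W) : 2 / 3 ≤ randomVertices n {ω | Rejects p x y z G ω} := by
  refine (two_thirds_le_finds hδ hJ hW hW0).trans (measure_mono ?_)
  rintro ω ⟨j, hj, hfind⟩
  obtain ⟨s, hf, hsW, -, -, hp⟩ := h ω
  obtain ⟨s₁, hr, h3, -, -, hs⟩ := hf.exists_represents (G := G) (b := b) ω
  obtain ⟨s', he, h0⟩ := hr.rejects_of_finds (Search.sound_start 0) hfind
    (by rw [h3, hsW]; exact hj)
  exact ⟨s', hp _ (hs _ he), h0⟩

theorem Prepares.hasComplexityAtMost (h : Prepares p b x y z G W T) (hW : 0 ≤ W) :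
    HasComplexityAtMost p x y z G (T + 84 * W + 110) := by
  intro ω
  obtain ⟨s, hf, hsW, ht, hq, hp⟩ := h ω
  obtain ⟨s₁, hr, h3, ht₁, hq₁, hs⟩ := hf.exists_represents (G := G) (b := b) ω
  obtain ⟨s', he, -, ht', hq'⟩ := hr.exec_searchProg (b := b) (ω := ω) (Search.sound_start 0)
  rw [h3, hsW] at ht' hq'
  have hc := (Nat.ceil_lt_add_one hW).le
  have h1 : s'.queries ≤ T + 25 + ⌈W⌉₊ * 84 + 1 := by omega
  have h2 : s'.time ≤ T + 25 + ⌈W⌉₊ * 84 + 1 := by omega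
  have h1' : (s'.queries : ℝ) ≤ T + 25 + ⌈W⌉₊ * 84 + 1 := by exact_mod_cast h1
  have h2' : (s'.time : ℝ) ≤ T + 25 + ⌈W⌉₊ * 84 + 1 := by exact_mod_cast h2
  exact ⟨s', hp _ (hs _ he), by linarith, by linarith⟩

end Run

/-- Doubling of the real register `8`, and counting in the real register `9`, until the threshold
in the real register `10` is reached. -/
def doubleProg : Prog := .while (.rlt 8 10) (.pre [.radd 8 8 8] (.op (.radd 9 9 5)))

theorem exec_doubleProg {n : ℕ} (G : ErasedGraph n) (ω : ℕ → Fin n) {J : ℕ} {s : State}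
    (hJ : s.real 10 ≤ 2 ^ J) (hmin : ∀ i < J, (2 : ℝ) ^ i < s.real 10) (h5 : s.real 5 = 1)
    (h8 : s.real 8 = 1) (h9 : s.real 9 = 1) :
    ∃ s', Exec G ω doubleProg s s' ∧ s'.reg = s.reg ∧ s'.mem = s.mem ∧ s'.drawn = s.drawn ∧
      s'.queries = s.queries ∧ s'.time = s.time + 3 * J + 1 ∧ s'.real 8 = 2 ^ J ∧
      s'.real 9 = J + 1 ∧ ∀ i, i ≠ 8 → i ≠ 9 → s'.real i = s.real i := by
  suffices ∀ m j, j + m = J → ∀ s : State, s.real 10 ≤ 2 ^ J →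
      (∀ i < J, (2 : ℝ) ^ i < s.real 10) → s.real 5 = 1 → s.real 8 = 2 ^ j →
      s.real 9 = j + 1 → ∃ s', Exec G ω doubleProg s s' ∧ s'.reg = s.reg ∧ s'.mem = s.mem ∧
      s'.drawn = s.drawn ∧ s'.queries = s.queries ∧ s'.time = s.time + 3 * m + 1 ∧
      s'.real 8 = 2 ^ J ∧ s'.real 9 = J + 1 ∧ ∀ i, i ≠ 8 → i ≠ 9 → s'.real i = s.real i from
    this J 0 (zero_add J) s hJ hmin h5 (by simpa using h8) (by simpa using h9)
  clear! s
  intro m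
  induction m with
  | zero =>
    rintro j rfl s hJ hmin h5 h8 h9
    refine ⟨s.tick, .while_false ?_, rfl, rfl, rfl, rfl, rfl, h8, h9, fun i _ _ => rfl⟩
    simp only [Test.Holds, h8, not_lt]
    exact hJ
  | succ m ih =>
    intro j hj s hJ hmin h5 h8 h9
    have hbody : Prog.LoopFree (.pre [.radd 8 8 8] (.op (.radd 9 9 5))) := by
      simp [Prog.pre, Prog.LoopFree]
    have he := hbody.exec G ω s.tick
    obtain ⟨s', he', hreg, hmem, hd, hq, ht, hr8, hr9, hr⟩ := ih (j + 1) (by omega)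
      (Prog.eval G ω (.pre [.radd 8 8 8] (.op (.radd 9 9 5))) s.tick)
      (by simpa [Prog.pre, Prog.eval, Instr.run, State.tick, State.setReal] using hJ)
      (by simpa [Prog.pre, Prog.eval, Instr.run, State.tick, State.setReal] using hmin)
      (by simpa [Prog.pre, Prog.eval, Instr.run, State.tick, State.setReal] using h5)
      (by simp [Prog.pre, Prog.eval, Instr.run, State.tick, State.setReal, h8, pow_succ, mul_two])
      (by simp [Prog.pre, Prog.eval, Instr.run, State.tick, State.setReal, h5, h9])
    refine ⟨s', .while_true ?_ he he', hreg, hmem, hd, hq, ?_, hr8, hr9, fun i h8 h9 => ?_⟩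
    · simp only [Test.Holds, h8]
      exact hmin j (by omega)
    · rw [ht]
      simp [Prog.pre, Prog.eval, Instr.run, State.tick, State.setReal]
      omega
    · rw [hr i h8 h9]
      simp [Prog.pre, Prog.eval, Instr.run, State.tick, State.setReal, h8, h9]

/-- The least power of two above a given threshold. -/
theorem exists_least_two_pow (th : ℝ) :
    ∃ J : ℕ, th ≤ 2 ^ J ∧ ∀ i < J, (2 : ℝ) ^ i < th := by
  classical
  have hex : ∃ J : ℕ, th ≤ 2 ^ J := by
    obtain ⟨J, hJ⟩ := pow_unbounded_of_one_lt th (by norm_num : (1 : ℝ) < 2)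
    exact ⟨J, hJ.le⟩
  exact ⟨Nat.find hex, Nat.find_spec hex, fun i hi => not_le.1 (Nat.find_min hex hi)⟩

theorem two_pow_lt_of_least {th : ℝ} (hth : 1 < th) {J : ℕ} (hJ : th ≤ 2 ^ J)
    (hmin : ∀ i < J, (2 : ℝ) ^ i < th) : (2 : ℝ) ^ J < 2 * th := by
  rcases J with _ | J
  · simp at hJ; linarith
  · have := hmin J (Nat.lt_succ_self J)
    rw [pow_succ]
    linarith

/-- The logarithmic factor: the number of levels is `O(log r)`. -/
theorem natCast_add_three_le_log {r : ℝ} (hr : 2 < r) {J : ℕ} (hJ : (2 : ℝ) ^ J ≤ 100 * r) :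
    (J : ℝ) + 3 ≤ 22 * Real.log r := by
  have h1 := Real.log_le_log (by positivity) hJ
  rw [Real.log_pow, Real.log_mul (by norm_num) (by linarith)] at h1
  have h2 : Real.log 100 ≤ 7 * Real.log 2 := by
    rw [← Nat.cast_ofNat (n := 7), ← Real.log_pow]
    exact Real.log_le_log (by norm_num) (by norm_num)
  have h3 := Real.log_le_log (by norm_num) hr.le
  have h4 := Real.log_two_gt_d9
  nlinarith [(Nat.cast_nonneg J : (0 : ℝ) ≤ J)]

/-- The tester that knows the average degree `d`: with `p` the least power of two above
`10 / ((ε - 2 * α) * d)` and `l = log₂ p + 1`, it searches with a budget of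
`min (24 * p * (l * d + 1)) (48 * p ^ 2)`, in the mode for which this budget suffices. It rejects
if `d < 1`. -/
def testerOfAvgDegree : Prog :=
  .pre [.rconst 5 1] <|
  .ite (.rlt 2 5) (.op (.const 0 0)) <|
  .seq (.pre [.rsub 11 0 1, .rsub 11 11 1, .rmul 12 11 2, .rconst 13 10, .rdiv 10 13 12,
    .rconst 8 1] (.op (.rconst 9 1))) <|
  .seq doubleProg <|
  .seq (.pre [.rmul 13 9 2, .radd 13 13 5, .rconst 14 24, .rmul 14 14 8, .rmul 13 14 13,
    .rmul 15 8 8, .rconst 14 48] (.op (.rmul 15 14 15))) <|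
  .ite (.rlt 13 15) (.pre [.radd 3 13 4] (runProg false)) (.pre [.radd 3 15 4] (runProg true))

/-- The tester that does not know the average degree: with `p` the least power of two above
`20 / (ε - 2 * α) + 60` and `l = log₂ p + 1`, it searches with a budget of
`24 * p * (l + 2)`, with limits proportional to the degree of the start vertex. -/
def tester : Prog :=
  .seq (.pre [.rconst 5 1, .rsub 11 0 1, .rsub 11 11 1, .rconst 12 20, .rdiv 10 12 11,
    .rconst 12 60, .radd 10 10 12, .rconst 8 1] (.op (.rconst 9 1))) <|
  .seq doubleProg <|
  .seq (.pre [.rconst 12 2, .radd 13 9 12, .rconst 12 24, .rmul 12 12 8] (.op (.rmul 3 12 13)))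
    (runProg false)

theorem prepares_tester {n : ℕ} (G : ErasedGraph n) {ε α : ℝ} {J : ℕ}
    (hJ : 20 / (ε - 2 * α) + 60 ≤ 2 ^ J)
    (hmin : ∀ i < J, (2 : ℝ) ^ i < 20 / (ε - 2 * α) + 60) :
    Prepares tester false ε α 0 G (24 * 2 ^ J * (J + 3)) (3 * J + 20) := by
  intro ω
  have hβ : ε - α - α = ε - 2 * α := by ring
  set pre₁ : Prog := .pre [.rconst 5 1, .rsub 11 0 1, .rsub 11 11 1, .rconst 12 20,
    .rdiv 10 12 11, .rconst 12 60, .radd 10 10 12, .rconst 8 1] (.op (.rconst 9 1)) with hpre₁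
  set pre₂ : Prog := .pre [.rconst 12 2, .radd 13 9 12, .rconst 12 24, .rmul 12 12 8]
    (.op (.rmul 3 12 13)) with hpre₂
  have hl₁ : pre₁.LoopFree := by simp [hpre₁, Prog.pre, Prog.LoopFree]
  have hl₂ : pre₂.LoopFree := by simp [hpre₂, Prog.pre, Prog.LoopFree]
  set s₁ := pre₁.eval G ω (State.initial n ε α 0) with hs₁
  have h10 : s₁.real 10 = 20 / (ε - 2 * α) + 60 := by
    simp [hs₁, hpre₁, Prog.pre, Prog.eval, Instr.run, State.tick, State.setReal, State.initial,
      hβ]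
  obtain ⟨s₂, he₂, hreg, hmem, hd, hq, ht, h8, h9, hr⟩ := exec_doubleProg G ω (J := J) (s := s₁)
    (h10 ▸ hJ) (h10 ▸ hmin)
    (by simp [hs₁, hpre₁, Prog.pre, Prog.eval, Instr.run, State.tick, State.setReal])
    (by simp [hs₁, hpre₁, Prog.pre, Prog.eval, Instr.run, State.tick, State.setReal])
    (by simp [hs₁, hpre₁, Prog.pre, Prog.eval, Instr.run, State.tick, State.setReal])
  have h4 := hr 4 (by norm_num) (by norm_num)
  simp [hs₁, hpre₁, Prog.pre, Prog.eval, Instr.run, State.tick, State.setReal, State.initial]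
    at hreg hmem hd hq ht h4
  refine ⟨pre₂.eval G ω s₂, ?_, ?_, ?_, ?_, fun s' h => ?_⟩
  · constructor <;>
      simp [hpre₂, Prog.pre, Prog.eval, Instr.run, State.tick, State.setReal, hreg, hmem, hd, h4]
  · simp [hpre₂, Prog.pre, Prog.eval, Instr.run, State.tick, State.setReal, h8, h9]
    ring
  · simp [hpre₂, Prog.pre, Prog.eval, Instr.run, State.tick, State.setReal, ht]
    omega
  · simp [hpre₂, Prog.pre, Prog.eval, Instr.run, State.tick, State.setReal, hq]
  · exact .seq (hl₁.exec G ω _) <| .seq he₂ <| .seq (hl₂.exec G ω _) h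

theorem prepares_testerOfAvgDegree {n : ℕ} (G : ErasedGraph n) {ε α d : ℝ} {J : ℕ} (hd1 : 1 ≤ d)
    (hJ : 10 / ((ε - 2 * α) * d) ≤ 2 ^ J)
    (hmin : ∀ i < J, (2 : ℝ) ^ i < 10 / ((ε - 2 * α) * d)) :
    (24 * 2 ^ J * ((J + 1) * d + 1) < 48 * (2 ^ J * 2 ^ J) →
      Prepares testerOfAvgDegree false ε α d G (24 * 2 ^ J * ((J + 1) * d + 1)) (3 * J + 22)) ∧
    (¬ 24 * 2 ^ J * ((J + 1) * d + 1) < 48 * (2 ^ J * 2 ^ J) →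
      Prepares testerOfAvgDegree true ε α d G (48 * (2 ^ J * 2 ^ J)) (3 * J + 22)) := by
  have hβ : ε - α - α = ε - 2 * α := by ring
  set pre₁ : Prog := .pre [.rsub 11 0 1, .rsub 11 11 1, .rmul 12 11 2, .rconst 13 10,
    .rdiv 10 13 12, .rconst 8 1] (.op (.rconst 9 1)) with hpre₁
  set pre₂ : Prog := .pre [.rmul 13 9 2, .radd 13 13 5, .rconst 14 24, .rmul 14 14 8,
    .rmul 13 14 13, .rmul 15 8 8, .rconst 14 48] (.op (.rmul 15 14 15)) with hpre₂
  have hl₁ : pre₁.LoopFree := by simp [hpre₁, Prog.pre, Prog.LoopFree]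
  have hl₂ : pre₂.LoopFree := by simp [hpre₂, Prog.pre, Prog.LoopFree]
  have main : ∀ ω : ℕ → Fin n, ∃ s, Fresh n s ∧ s.real 13 = 24 * 2 ^ J * ((J + 1) * d + 1) ∧
      s.real 15 = 48 * (2 ^ J * 2 ^ J) ∧ s.time ≤ 3 * J + 20 ∧ s.queries = 0 ∧
      ∀ s', Exec G ω (.ite (.rlt 13 15) (.pre [.radd 3 13 4] (runProg false))
        (.pre [.radd 3 15 4] (runProg true))) s s' →
        Exec G ω testerOfAvgDegree (State.initial n ε α d) s' := by
    intro ω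
    set s₀ := ((Instr.rconst 5 1).run G ω (State.initial n ε α d)).tick with hs₀
    set s₁ := pre₁.eval G ω s₀ with hs₁
    have h10 : s₁.real 10 = 10 / ((ε - 2 * α) * d) := by
      simp [hs₁, hs₀, hpre₁, Prog.pre, Prog.eval, Instr.run, State.tick, State.setReal,
        State.initial, hβ]
    obtain ⟨s₂, he₂, hreg, hmem, hd, hq, ht, h8, h9, hr⟩ := exec_doubleProg G ω (J := J)
      (s := s₁) (h10 ▸ hJ) (h10 ▸ hmin)
      (by simp [hs₁, hs₀, hpre₁, Prog.pre, Prog.eval, Instr.run, State.tick, State.setReal])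
      (by simp [hs₁, hs₀, hpre₁, Prog.pre, Prog.eval, Instr.run, State.tick, State.setReal])
      (by simp [hs₁, hs₀, hpre₁, Prog.pre, Prog.eval, Instr.run, State.tick, State.setReal])
    have h4 := hr 4 (by norm_num) (by norm_num)
    have h2 := hr 2 (by norm_num) (by norm_num)
    have h5 := hr 5 (by norm_num) (by norm_num)
    simp [hs₁, hs₀, hpre₁, Prog.pre, Prog.eval, Instr.run, State.tick, State.setReal,
      State.initial] at hreg hmem hd hq ht h4 h2 h5
    refine ⟨pre₂.eval G ω s₂, ?_, ?_, ?_, ?_, ?_, fun s' h => ?_⟩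
    · constructor <;>
        simp [hpre₂, Prog.pre, Prog.eval, Instr.run, State.tick, State.setReal, hreg, hmem, hd,
          h4]
    · simp [hpre₂, Prog.pre, Prog.eval, Instr.run, State.tick, State.setReal, h8, h9, h2, h5]
    · simp [hpre₂, Prog.pre, Prog.eval, Instr.run, State.tick, State.setReal, h8]
    · simp [hpre₂, Prog.pre, Prog.eval, Instr.run, State.tick, State.setReal, ht]
      omega
    · simp [hpre₂, Prog.pre, Prog.eval, Instr.run, State.tick, State.setReal, hq]
    · refine .seq (.op _ _) <| .ite_false ?_ <| .seq (hl₁.exec G ω _) <| .seq he₂ <|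
        .seq (hl₂.exec G ω _) h
      simpa [Test.Holds, Instr.run, State.tick, State.setReal, State.initial] using hd1
  constructor
  · intro hlt ω
    obtain ⟨s, ⟨h1, h6, h7, hr4, hd, hm⟩, h13, h15, ht, hq, he⟩ := main ω
    refine ⟨(Instr.radd 3 13 4).run G ω s.tick, ?_, ?_, ?_, ?_, fun s' h => he s' ?_⟩
    · constructor <;> simp [Instr.run, State.tick, State.setReal, h1, h6, h7, hr4, hd, hm]
    · simp [Instr.run, State.tick, State.setReal, hr4, h13]
    · simp [Instr.run, State.tick, State.setReal]; omega
    · simp [Instr.run, State.tick, State.setReal, hq]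
    · exact .ite_true (by simp only [Test.Holds, h13, h15]; exact hlt) (.seq (.op _ _) h)
  · intro hlt ω
    obtain ⟨s, ⟨h1, h6, h7, hr4, hd, hm⟩, h13, h15, ht, hq, he⟩ := main ω
    refine ⟨(Instr.radd 3 15 4).run G ω s.tick, ?_, ?_, ?_, ?_, fun s' h => he s' ?_⟩
    · constructor <;> simp [Instr.run, State.tick, State.setReal, h1, h6, h7, hr4, hd, hm]
    · simp [Instr.run, State.tick, State.setReal, hr4, h15]
    · simp [Instr.run, State.tick, State.setReal]; omega
    · simp [Instr.run, State.tick, State.setReal, hq]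
    · exact .ite_false (by simp only [Test.Holds, h13, h15]; exact hlt) (.seq (.op _ _) h)

/-! ### Correctness and complexity -/

section Testers

variable {n : ℕ} {G : ErasedGraph n} {ε α : ℝ}

theorem ErasedGraph.HasDensity.le_one [NeZero n] {b : Bool} {δ : ℝ}
    (h : G.HasDensity b δ) : δ ≤ 1 := by
  obtain ⟨ρ, h01, -, hsum⟩ := h
  have hn : (0 : ℝ) < n := by exact_mod_cast Nat.pos_of_ne_zero (NeZero.ne n)
  have h1 := Finset.sum_le_sum fun v (_ : v ∈ Finset.univ) => (h01 v).2
  simp only [Finset.sum_const, Finset.card_univ, Fintype.card_fin, nsmul_eq_mul, mul_one] at h1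
  exact le_of_mul_le_mul_right (by linarith) hn

theorem HasComplexityAtMost.mono {n : ℕ} {G : ErasedGraph n} {p : Prog} {x y z B B' : ℝ}
    (h : HasComplexityAtMost p x y z G B) (hB : B ≤ B') : HasComplexityAtMost p x y z G B' :=
  fun ω => (h ω).imp fun _ hs => ⟨hs.1, hs.2.1.trans hB, hs.2.2.trans hB⟩

/-- With `d` the average degree, phases up to the order of `1 / ((ε - 2 * α) * d)` suffice; the factor
`d` in their expected cost cancels, so that the budget does not depend on `d`. -/
theorem testsOneSided_tester [NeZero n] (hn : 2 ≤ n) (hε : 0 < ε)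
    (hαε : α < ε / 2) (hα : G.IsErased α) {J : ℕ} (hJ : 20 / (ε - 2 * α) + 60 ≤ 2 ^ J)
    (hmin : ∀ i < J, (2 : ℝ) ^ i < 20 / (ε - 2 * α) + 60) :
    TestsOneSided tester ε α 0 G ε SimpleGraph.Connected := by
  have hβ : 0 < ε - 2 * α := by linarith
  have hp := prepares_tester G hJ hmin
  have hth : 0 < 20 / (ε - 2 * α) := by positivity
  refine ⟨hp.accepts, fun hfar => ?_⟩
  rcases le_or_gt G.avgDegree (1 / 2) with hd | hd
  · -- many isolated vertices: phases up to `2 ^ 4` suffice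
    refine hp.two_thirds_le_rejects (ErasedGraph.hasDensity_of_avgDegree_le hn hd false) (J := 4)
      (by norm_num) ((G.expectedCost_false_le 4).trans ?_) (by positivity)
    have h1 : (60 : ℝ) * 3 ≤ 2 ^ J * (J + 3) :=
      mul_le_mul (by linarith) (by linarith [(Nat.cast_nonneg J : (0 : ℝ) ≤ J)]) (by norm_num)
        (by positivity)
    norm_num
    linarith
  · have hd0 : 0 < G.avgDegree := by linarith
    have hδ := ErasedGraph.hasDensity_of_isFar hn hε hα hfar false
    have hx : 0 < (ε - 2 * α) * G.avgDegree := mul_pos hβ hd0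
    have hx2 : (ε - 2 * α) * G.avgDegree ≤ 2 := by linarith [hδ.le_one]
    -- the search does not know that phases up to `2 ^ J'` suffice
    obtain ⟨J', hJ', hmin'⟩ := exists_least_two_pow (10 / ((ε - 2 * α) * G.avgDegree))
    have h1 : 1 < 10 / ((ε - 2 * α) * G.avgDegree) := by
      rw [lt_div_iff₀ hx]; linarith
    have hlt := two_pow_lt_of_least h1 hJ' hmin'
    have hle : 10 / ((ε - 2 * α) * G.avgDegree) ≤ 20 / (ε - 2 * α) := by
      rw [div_le_div_iff₀ hx hβ]
      nlinarith
    have hJJ : J' ≤ J := by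
      by_contra hcon
      linarith [hmin' J (not_le.1 hcon)]
    refine hp.two_thirds_le_rejects hδ (J := J') ?_ ((G.expectedCost_false_le J').trans ?_)
      (by positivity)
    · rw [div_le_iff₀ hx] at hJ'
      linarith
    · have hJJ' : (J' : ℝ) ≤ J := by exact_mod_cast hJJ
      have h2 : 0 ≤ ((J' : ℝ) + 1) * G.avgDegree + 1 := by positivity
      have h3 : ((J' : ℝ) + 1) * G.avgDegree + 1 ≤ (J + 3) * G.avgDegree := by nlinarith
      have h4 : 2 ^ J' * (((J' : ℝ) + 1) * G.avgDegree + 1) ≤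
          2 * (10 / ((ε - 2 * α) * G.avgDegree)) * ((J + 3) * G.avgDegree) :=
        mul_le_mul hlt.le h3 h2 (by positivity)
      have h5 : 2 * (10 / ((ε - 2 * α) * G.avgDegree)) * (((J : ℝ) + 3) * G.avgDegree) =
          20 / (ε - 2 * α) * (J + 3) := by
        field_simp
        ring
      have h6 : 20 / (ε - 2 * α) * ((J : ℝ) + 3) ≤ 2 ^ J * (J + 3) :=
        mul_le_mul_of_nonneg_right (by linarith) (by positivity)
      linarith

theorem hasComplexityAtMost_tester (hαε : α < ε / 2) {J : ℕ}
    (hJ : 20 / (ε - 2 * α) + 60 ≤ 2 ^ J)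
    (hmin : ∀ i < J, (2 : ℝ) ^ i < 20 / (ε - 2 * α) + 60) :
    HasComplexityAtMost tester ε α 0 G
      (10000000 * max 1 (1 / (ε - 2 * α) * Real.log (1 / (ε - 2 * α)))) := by
  have hβ : 0 < ε - 2 * α := by linarith
  have hp := prepares_tester G hJ hmin
  refine (hp.hasComplexityAtMost (by positivity)).mono ?_
  push_cast
  set r := 1 / (ε - 2 * α) with hr
  have hr0 : 0 < r := by positivity
  have hth : 20 / (ε - 2 * α) + 60 = 20 * r + 60 := by rw [hr]; ring
  have hlt := two_pow_lt_of_least (by rw [hth]; linarith) hJ hmin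
  rw [hth] at hlt hJ
  have hJ0 : (0 : ℝ) ≤ J := Nat.cast_nonneg J
  have hJW : (J : ℝ) + 3 ≤ 2 ^ J * (J + 3) := by nlinarith
  suffices 2 ^ J * ((J : ℝ) + 3) ≤ 4400 * max 1 (r * Real.log r) by
    have h1 := le_max_left 1 (r * Real.log r)
    nlinarith
  -- for `r ≤ 2` the logarithm may vanish, but then the budget is bounded by a constant
  rcases le_or_gt r 2 with h2 | h2
  · have hJ8 : J ≤ 8 := by
      by_contra hcon
      have : (2 : ℝ) ^ 9 ≤ 2 ^ J := pow_le_pow_right₀ (by norm_num) (by omega)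
      norm_num at this
      linarith
    have hJ8' : (J : ℝ) ≤ 8 := by exact_mod_cast hJ8
    have h1 : (2 : ℝ) ^ J * (J + 3) ≤ 200 * 11 :=
      mul_le_mul (by linarith) (by linarith) (by positivity) (by norm_num)
    have h3 := le_max_left 1 (r * Real.log r)
    linarith
  · have h1 := natCast_add_three_le_log h2 (J := J) (by linarith)
    have h3 : (2 : ℝ) ^ J * (J + 3) ≤ (100 * r) * (22 * Real.log r) :=
      mul_le_mul (by linarith) h1 (by positivity) (by positivity)
    have h4 := le_max_right 1 (r * Real.log r)
    have h5 : 0 ≤ max 1 (r * Real.log r) := le_trans zero_le_one (le_max_left _ _)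
    nlinarith

theorem testerOfAvgDegree_of_lt_one {d : ℝ} (hd : d < 1) (ω : ℕ → Fin n) :
    ∃ s, Exec G ω testerOfAvgDegree (State.initial n ε α d) s ∧ s.reg 0 = 0 ∧ s.queries ≤ 3 ∧
      s.time ≤ 3 := by
  refine ⟨_, .seq (.op _ _) (.ite_true ?_ (.op _ _)), ?_, ?_, ?_⟩
  · simpa [Test.Holds, Instr.run, State.tick, State.setReal, State.initial] using hd
  all_goals simp [Instr.run, State.tick, State.setReal, State.setReg, State.initial]

theorem testsOneSided_testerOfAvgDegree [NeZero n] (hn : 2 ≤ n) (hε : 0 < ε)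
    (hαε : α < ε / 2) (hα : G.IsErased α) (hd1 : 1 ≤ G.avgDegree) {J : ℕ}
    (hJ : 10 / ((ε - 2 * α) * G.avgDegree) ≤ 2 ^ J)
    (hmin : ∀ i < J, (2 : ℝ) ^ i < 10 / ((ε - 2 * α) * G.avgDegree)) :
    TestsOneSided testerOfAvgDegree ε α G.avgDegree G ε SimpleGraph.Connected := by
  have hβ : 0 < ε - 2 * α := by linarith
  have hd0 : 0 < G.avgDegree := by linarith
  have hx : 0 < (ε - 2 * α) * G.avgDegree := mul_pos hβ hd0
  obtain ⟨hp₁, hp₂⟩ := prepares_testerOfAvgDegree G hd1 hJ hmin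
  rw [div_le_iff₀ hx] at hJ
  by_cases hlt : 24 * 2 ^ J * ((J + 1) * G.avgDegree + 1) < 48 * ((2 : ℝ) ^ J * 2 ^ J)
  · exact ⟨(hp₁ hlt).accepts, fun hfar => (hp₁ hlt).two_thirds_le_rejects
      (ErasedGraph.hasDensity_of_isFar hn hε hα hfar false) (J := J) (by linarith)
      (G.expectedCost_false_le J) (by positivity)⟩
  · exact ⟨(hp₂ hlt).accepts, fun hfar => (hp₂ hlt).two_thirds_le_rejects
      (ErasedGraph.hasDensity_of_isFar hn hε hα hfar true) (J := J) (by linarith)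
      (G.expectedCost_true_le J) (by positivity)⟩

theorem hasComplexityAtMost_testerOfAvgDegree {d : ℝ} (hα0 : 0 ≤ α) (hεd : ε < 2 / d)
    (hαε : α < ε / 2) (hd1 : 1 ≤ d) {J : ℕ}
    (hJ : 10 / ((ε - 2 * α) * d) ≤ 2 ^ J)
    (hmin : ∀ i < J, (2 : ℝ) ^ i < 10 / ((ε - 2 * α) * d)) :
    HasComplexityAtMost testerOfAvgDegree ε α d G
      (10000000 * max 1 (min (1 / ((ε - 2 * α) * d) ^ 2)
        (1 / (ε - 2 * α) * Real.log (1 / ((ε - 2 * α) * d))))) := by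
  have hβ : 0 < ε - 2 * α := by linarith
  have hd0 : 0 < d := by linarith
  have hx : 0 < (ε - 2 * α) * d := mul_pos hβ hd0
  have hx2 : (ε - 2 * α) * d < 2 := by
    rw [lt_div_iff₀ hd0] at hεd
    nlinarith
  obtain ⟨hp₁, hp₂⟩ := prepares_testerOfAvgDegree G hd1 hJ hmin
  set r := 1 / ((ε - 2 * α) * d) with hr
  have hr0 : 0 < r := by positivity
  have hr2 : 1 / 2 < r := by rw [hr, div_lt_div_iff₀ (by norm_num) hx]; linarith
  have hrd : 1 / (ε - 2 * α) = r * d := by rw [hr]; field_simp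
  have hsq : 1 / ((ε - 2 * α) * d) ^ 2 = r ^ 2 := by rw [hr, div_pow, one_pow]
  have hth : 10 / ((ε - 2 * α) * d) = 10 * r := by rw [hr]; ring
  have hpow := two_pow_lt_of_least (by rw [hth]; linarith) hJ hmin
  rw [hth] at hpow
  rw [hrd, hsq]
  set M := max 1 (min (r ^ 2) (r * d * Real.log r)) with hM
  have hM1 : 1 ≤ M := le_max_left _ _
  have hJ0 : (0 : ℝ) ≤ J := Nat.cast_nonneg J
  have hp1 : (1 : ℝ) ≤ 2 ^ J := one_le_pow₀ (by norm_num)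
  have hJp : (J : ℝ) ≤ 2 ^ J := by exact_mod_cast (Nat.lt_two_pow_self (n := J)).le
  have hmin' : min (24 * 2 ^ J * ((J + 1) * d + 1)) (48 * ((2 : ℝ) ^ J * 2 ^ J)) ≤
      100000 * M := by
    rcases le_or_gt r 2 with h2 | h2
    · refine (min_le_right _ _).trans ?_
      have : (2 : ℝ) ^ J * 2 ^ J ≤ 40 * 40 :=
        mul_le_mul (by linarith) (by linarith) (by positivity) (by norm_num)
      linarith
    · have h1 := natCast_add_three_le_log h2 (J := J) (by linarith)
      have hA : 48 * ((2 : ℝ) ^ J * 2 ^ J) ≤ 100000 * r ^ 2 := by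
        have : (2 : ℝ) ^ J * 2 ^ J ≤ (20 * r) * (20 * r) :=
          mul_le_mul (by linarith) (by linarith) (by positivity) (by positivity)
        nlinarith
      have hB : 24 * 2 ^ J * (((J : ℝ) + 1) * d + 1) ≤ 100000 * (r * d * Real.log r) := by
        have h3 : ((J : ℝ) + 1) * d + 1 ≤ 22 * Real.log r * d := by nlinarith
        have h4 : 2 ^ J * (((J : ℝ) + 1) * d + 1) ≤ (20 * r) * (22 * Real.log r * d) :=
          mul_le_mul (by linarith) h3 (by positivity) (by positivity)
        have h5 : 0 ≤ r * d * Real.log r := by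
          have := Real.log_nonneg (show 1 ≤ r by linarith)
          positivity
        nlinarith
      rcases le_total (r ^ 2) (r * d * Real.log r) with h | h
      · refine (min_le_right _ _).trans (hA.trans ?_)
        have : r ^ 2 ≤ M := by rw [hM, min_eq_left h]; exact le_max_right _ _
        linarith
      · refine (min_le_left _ _).trans (hB.trans ?_)
        have : r * d * Real.log r ≤ M := by rw [hM, min_eq_right h]; exact le_max_right _ _
        linarith
  -- the budget also dominates the time spent on computing it
  have hJW₁ : (J : ℝ) ≤ 24 * 2 ^ J * ((J + 1) * d + 1) := by
    have : (1 : ℝ) ≤ (J + 1) * d + 1 := by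
      have : 0 ≤ ((J : ℝ) + 1) * d := by positivity
      linarith
    nlinarith
  have hJW₂ : (J : ℝ) ≤ 48 * ((2 : ℝ) ^ J * 2 ^ J) := by nlinarith
  by_cases hlt : 24 * 2 ^ J * ((J + 1) * d + 1) < 48 * ((2 : ℝ) ^ J * 2 ^ J)
  · rw [min_eq_left hlt.le] at hmin'
    refine ((hp₁ hlt).hasComplexityAtMost (by positivity)).mono ?_
    push_cast
    linarith
  · rw [min_eq_right (not_lt.1 hlt)] at hmin'
    refine ((hp₂ hlt).hasComplexityAtMost (by positivity)).mono ?_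
    push_cast
    linarith

end Testers

theorem theorem1 :
    -- the average degree is given to the tester
    (∃ (p : Prog) (C : ℝ), ∀ (n : ℕ) [NeZero n] (G : ErasedGraph n) (ε α : ℝ),
      0 < G.avgDegree → 0 < ε → ε < 2 / G.avgDegree → 0 ≤ α → α < ε / 2 → G.IsErased α →
        TestsOneSided p ε α G.avgDegree G ε SimpleGraph.Connected ∧
        HasComplexityAtMost p ε α G.avgDegree G
          (C * max 1 (min (1 / ((ε - 2 * α) * G.avgDegree) ^ 2)
            (1 / (ε - 2 * α) * Real.log (1 / ((ε - 2 * α) * G.avgDegree)))))) ∧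
    -- the average degree is not given to the tester
    (∃ (p : Prog) (C : ℝ), ∀ (n : ℕ) [NeZero n] (G : ErasedGraph n) (ε α : ℝ),
      2 ≤ n → 0 < ε → 0 ≤ α → α < ε / 2 → G.IsErased α →
        TestsOneSided p ε α 0 G ε SimpleGraph.Connected ∧
        HasComplexityAtMost p ε α 0 G
          (C * max 1 (1 / (ε - 2 * α) * Real.log (1 / (ε - 2 * α))))) := by
  refine ⟨⟨testerOfAvgDegree, 10000000, ?_⟩, ⟨tester, 10000000, ?_⟩⟩
  · intro n _ G ε α hd0 hε hεd hα0 hαε hα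
    have hn := G.two_le_of_avgDegree_pos hd0
    rcases lt_or_ge G.avgDegree 1 with hd | hd
    · have hrun := testerOfAvgDegree_of_lt_one (n := n) (G := G) (ε := ε) (α := α) hd
      refine ⟨⟨fun hG => ?_, fun _ => ?_⟩, fun ω => ?_⟩
      · exact absurd (ErasedGraph.one_le_avgDegree_of_satisfies hn hG) (not_le.2 hd)
      · have huniv : {ω | Rejects testerOfAvgDegree ε α G.avgDegree G ω} = Set.univ :=
          Set.eq_univ_of_forall fun ω => (hrun ω).imp fun _ hs => ⟨hs.1, hs.2.1⟩
        rw [huniv, measure_univ]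
        exact ENNReal.div_le_of_le_mul (by norm_num)
      · obtain ⟨s, he, -, hq, ht⟩ := hrun ω
        have hM := le_max_left 1 (min (1 / ((ε - 2 * α) * G.avgDegree) ^ 2)
            (1 / (ε - 2 * α) * Real.log (1 / ((ε - 2 * α) * G.avgDegree))))
        have hq' : (s.queries : ℝ) ≤ 3 := by exact_mod_cast hq
        have ht' : (s.time : ℝ) ≤ 3 := by exact_mod_cast ht
        exact ⟨s, he, by linarith, by linarith⟩
    · obtain ⟨J, hJ, hmin⟩ := exists_least_two_pow (10 / ((ε - 2 * α) * G.avgDegree))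
      exact ⟨testsOneSided_testerOfAvgDegree hn hε hαε hα hd hJ hmin,
        hasComplexityAtMost_testerOfAvgDegree hα0 hεd hαε hd hJ hmin⟩
  · intro n _ G ε α hn hε _ hαε hα
    obtain ⟨J, hJ, hmin⟩ := exists_least_two_pow (20 / (ε - 2 * α) + 60)
    exact ⟨testsOneSided_tester hn hε hαε hα hJ hmin, hasComplexityAtMost_tester hαε hJ hmin⟩
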